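/- Let $n\ge 2$ and let $\mathbf B=\{1,\dots,n\}$ be the crystal of the vector representation of the quantum queer superalgebra $U_q(\mathfrak q(n))$: the box $a$ has weight $\mathrm{wt}(a)=\epsilon_a\in P=\bigoplus_{a=1}^n\mathbb Z\epsilon_a$; for $1\le i<n$ one has $\tilde f_i(i)=i+1$, $\tilde e_i(i+1)=i$, and $\tilde f_i,\tilde e_i$ send all other boxes to $0$; and $\tilde f_{\bar 1}=\tilde f_1$, $\tilde e_{\bar 1}=\tilde e_1$ on $\mathbf B$. Write $k_i,h_i=k_i-k_{i+1}$ for the elements of the dual lattice with $\langle k_i,\epsilon_a\rangle=\delta_{ia}$, and $\varepsilon_i(b)=\max\{k\ge 0:\tilde e_i^{\,k}b\neq0\}$, $\varphi_i(b)=\max\{k\ge0:\tilde f_i^{\,k}b\ne0\}$. The tensor powers $\mathbf B^{\otimes M}$ ($M\ge 0$; $\mathbf B^{\otimes 0}$ is one point of weight $0$ on which all operators are $0$) carry operators defined by $\mathrm{wt}(b_1\otimes b_2)=\mathrm{wt}(b_1)+\mathrm{wt}(b_2)$ and the tensor product rule (with $b\otimes 0=0\otimes b=0$) $$\tilde e_i(b_1\otimes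 b_2)=\begin{cases}\tilde e_ib_1\otimes b_2&\varphi_i(b_1)\ge\varepsilon_i(b_2),\\ b_1\otimes\tilde e_ib_2&\varphi_i(b_1)<\varepsilon_i(b_2),\end{cases}\qquad \tilde f_i(b_1\otimes b_2)=\begin{cases}\tilde f_ib_1\otimes b_2&\varphi_i(b_1)>\varepsilon_i(b_2),\\ b_1\otimes\tilde f_ib_2&\varphi_i(b_1)\le\varepsilon_i(b_2),\end{cases}$$ $$\tilde e_{\bar1}(b_1\otimes b_2)=\begin{cases}\tilde e_{\bar1}b_1\otimes b_2&\langle k_1,\mathrm{wt}\,b_2\rangle=\langle k_2,\mathrm{wt}\,b_2\rangle=0,\\ b_1\otimes\tilde e_{\bar1}b_2&\text{otherwise,}\end{cases}$$ and likewise for $\tilde f_{\bar 1}$. For $1\le i<n$ put $S_ib=\tilde f_i^{\,\langle h_i,\mathrm{wt}\,b\rangle}b$ if $\langle h_i,\mathrm{wt}\,b\rangle\ge0$ and $S_ib=\tilde e_i^{\,-\langle h_i,\mathrm{wt}\,b\rangle}b$ otherwise; let $S_w=S_{i_1}\cdots S_{i_r}$ for $w=s_{i_1}\cdots s_{i_r}$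 in the Weyl group, let $w_i=s_2\cdots s_i\,s_1\cdots s_{i-1}$ (so $w_1=1$), and let $\tilde e_{\bar i}=S_{w_i^{-1}}\,\tilde e_{\bar1}\,S_{w_i}$. An element $b\in\mathbf B^{\otimes M}$ is a $\mathfrak{gl}(n)$-highest weight vector if $\tilde e_ib=0$ for all $1\le i<n$, and a ($\mathfrak q(n)$-)highest weight vector if $\tilde e_ib=\tilde e_{\bar i}b=0$ for all $1\le i<n$. **Theorem.** Let $N\ge1$ and $j\in\{1,\dots,n\}$. Suppose that $b$ is a $\mathfrak{gl}(n)$-highest weight vector in $\mathbf B^{\otimes(N-1)}$, that $\tilde f_1\tilde f_2\cdots\tilde f_{j-1}b\ne0$, and that $$b_0=1\otimes\tilde f_1\tilde f_2\cdots\tilde f_{j-1}b$$ is a highest weight vector in $\mathbf B^{\otimes N}$. Then $b$ is a highest weight vector in $\mathbf B^{\otimes(N-1)}$; that is, $\tilde e_ib=\tilde e_{\bar i}b=0$ for all $1\le i<n$. -/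

import Mathlib

namespace QueerCrystal

/-- The labels `1, …, n` of the basis `ε₁, …, εₙ` of the weight lattice; they are also the boxes of
the crystal of the vector representation. -/
abbrev Letter (n : ℕ) : Type := {a : ℕ // 1 ≤ a ∧ a ≤ n}

/-- The weight lattice `P = ℤ ε₁ ⊕ ⋯ ⊕ ℤ εₙ`. -/
abbrev Weight (n : ℕ) : Type := Letter n → ℤ

/-- The basis weight `ε_i` (used for `1 ≤ i ≤ n`). -/
def epsWt (n i : ℕ) : Weight n := fun a => if a.1 = i then 1 else 0

/-- The simple root `α_i = ε_i - ε_{i+1}` (used for `1 ≤ i < n`). -/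
def simpleRoot (n i : ℕ) : Weight n := epsWt n i - epsWt n (i + 1)

/-- The pairing `⟨k_i, μ⟩`, that is, the coefficient of `ε_i` in `μ` (used for `1 ≤ i ≤ n`). -/
def kPair {n : ℕ} (i : ℕ) (μ : Weight n) : ℤ := if h : 1 ≤ i ∧ i ≤ n then μ ⟨i, h⟩ else 0

/-- The pairing `⟨h_i, μ⟩` with the simple coroot `h_i = k_i - k_{i+1}`. -/
def hPair {n : ℕ} (i : ℕ) (μ : Weight n) : ℤ := kPair i μ - kPair (i + 1) μ

/-- The `k`-th power of a partially defined map `g : B → B ⊔ {0}`, where `none` is the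
symbol `0` and `g 0 = 0`. -/
def iter {B : Type} (g : B → Option B) : ℕ → B → Option B
  | 0, b => some b
  | k + 1, b => (g b).bind (iter g k)

/-- Abstract `q(n)`-crystals (over the underlying `gl(n)`-crystals in which `ε_i` and `φ_i` are the
lengths of the `i`-strings). The value `none` stands for `0`. The axioms on `i` are imposed for the
simple indices `1 ≤ i < n`. -/
structure Crystal (n : ℕ) where
  /-- the underlying set -/
  carrier : Type
  /-- the weight map -/
  wt : carrier → Weight n
  /-- the even Kashiwara operators raising the weight -/
  e : ℕ → carrier → Option carrier
  /-- the even Kashiwara operators lowering the weight -/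
  f : ℕ → carrier → Option carrier
  /-- the function `ε_i` -/
  eps : ℕ → carrier → ℕ
  /-- the function `φ_i` -/
  phi : ℕ → carrier → ℕ
  /-- the odd Kashiwara operator raising the weight by `α_1` -/
  eOne : carrier → Option carrier
  /-- the odd Kashiwara operator lowering the weight by `α_1` -/
  fOne : carrier → Option carrier
  wt_e : ∀ i, 1 ≤ i → i < n → ∀ b b', e i b = some b' → wt b' = wt b + simpleRoot n i
  wt_f : ∀ i, 1 ≤ i → i < n → ∀ b b', f i b = some b' → wt b' = wt b - simpleRoot n i
  phi_eq : ∀ i, 1 ≤ i → i < n → ∀ b, (phi i b : ℤ) = eps i b + hPair i (wt b)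
  f_iff_e : ∀ i, 1 ≤ i → i < n → ∀ b b', f i b = some b' ↔ e i b' = some b
  eps_e : ∀ i, 1 ≤ i → i < n → ∀ b b', e i b = some b' → eps i b' + 1 = eps i b
  phi_e : ∀ i, 1 ≤ i → i < n → ∀ b b', e i b = some b' → phi i b' = phi i b + 1
  eps_f : ∀ i, 1 ≤ i → i < n → ∀ b b', f i b = some b' → eps i b' = eps i b + 1
  phi_f : ∀ i, 1 ≤ i → i < n → ∀ b b', f i b = some b' → phi i b' + 1 = phi i b
  eps_eq_zero : ∀ i, 1 ≤ i → i < n → ∀ b, e i b = none → eps i b = 0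
  phi_eq_zero : ∀ i, 1 ≤ i → i < n → ∀ b, f i b = none → phi i b = 0
  wt_nonneg : ∀ b a, 0 ≤ wt b a
  wt_eOne : ∀ b b', eOne b = some b' → wt b' = wt b + simpleRoot n 1
  wt_fOne : ∀ b b', fOne b = some b' → wt b' = wt b - simpleRoot n 1
  fOne_iff_eOne : ∀ b b', fOne b = some b' ↔ eOne b' = some b
  eOne_comm_e : ∀ i, 3 ≤ i → i < n → ∀ b, (e i b).bind eOne = (eOne b).bind (e i)
  eOne_comm_f : ∀ i, 3 ≤ i → i < n → ∀ b, (f i b).bind eOne = (eOne b).bind (f i)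
  fOne_comm_e : ∀ i, 3 ≤ i → i < n → ∀ b, (e i b).bind fOne = (fOne b).bind (e i)
  fOne_comm_f : ∀ i, 3 ≤ i → i < n → ∀ b, (f i b).bind fOne = (fOne b).bind (f i)
  eps_eOne : ∀ i, 3 ≤ i → i < n → ∀ b b', eOne b = some b' → eps i b' = eps i b
  phi_eOne : ∀ i, 3 ≤ i → i < n → ∀ b b', eOne b = some b' → phi i b' = phi i b

section Weights

variable {n : ℕ}

theorem kPair_add (i : ℕ) (μ ν : Weight n) : kPair i (μ + ν) = kPair i μ + kPair i ν := by
  unfold kPair; split <;> simp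

theorem kPair_sub (i : ℕ) (μ ν : Weight n) : kPair i (μ - ν) = kPair i μ - kPair i ν := by
  unfold kPair; split <;> simp

theorem hPair_add (i : ℕ) (μ ν : Weight n) : hPair i (μ + ν) = hPair i μ + hPair i ν := by
  unfold hPair; rw [kPair_add, kPair_add]; ring

theorem kPair_nonneg (i : ℕ) (μ : Weight n) (h : ∀ a, 0 ≤ μ a) : 0 ≤ kPair i μ := by
  unfold kPair; split
  · exact h _
  · exact le_rfl

theorem kPair_epsWt (i j : ℕ) (hi : 1 ≤ i) (hin : i ≤ n) :
    kPair i (epsWt n j) = if i = j then 1 else 0 := by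
  simp [kPair, epsWt, hi, hin]

end Weights

namespace Crystal

variable {n : ℕ}

theorem iter_e_ne_none_iff (B : Crystal n) {i : ℕ} (hi : 1 ≤ i) (hin : i < n) (k : ℕ)
    (b : B.carrier) : iter (B.e i) k b ≠ none ↔ k ≤ B.eps i b := by
  induction k generalizing b with
  | zero => simp [iter]
  | succ k ih =>
    rcases h : B.e i b with _ | b'
    · have := B.eps_eq_zero i hi hin b h
      simp [iter, h, this]
    · have := B.eps_e i hi hin b b' h
      simp only [iter, h, Option.bind_some, ih]
      omega

theorem iter_f_ne_none_iff (B : Crystal n) {i : ℕ} (hi : 1 ≤ i) (hin : i < n) (k : ℕ)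
    (b : B.carrier) : iter (B.f i) k b ≠ none ↔ k ≤ B.phi i b := by
  induction k generalizing b with
  | zero => simp [iter]
  | succ k ih =>
    rcases h : B.f i b with _ | b'
    · have := B.phi_eq_zero i hi hin b h
      simp [iter, h, this]
    · have := B.phi_f i hi hin b b' h
      simp only [iter, h, Option.bind_some, ih]
      omega

/-- `ε_i(b) = max {k | ẽ_i^k b ≠ 0}`. -/
theorem eps_isGreatest (B : Crystal n) (i : ℕ) (hi : 1 ≤ i) (hin : i < n) (b : B.carrier) :
    IsGreatest {k : ℕ | iter (B.e i) k b ≠ none} (B.eps i b) :=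
  ⟨(iter_e_ne_none_iff B hi hin _ _).2 le_rfl, fun _ hk => (iter_e_ne_none_iff B hi hin _ _).1 hk⟩

/-- `φ_i(b) = max {k | f̃_i^k b ≠ 0}`. -/
theorem phi_isGreatest (B : Crystal n) (i : ℕ) (hi : 1 ≤ i) (hin : i < n) (b : B.carrier) :
    IsGreatest {k : ℕ | iter (B.f i) k b ≠ none} (B.phi i b) :=
  ⟨(iter_f_ne_none_iff B hi hin _ _).2 le_rfl, fun _ hk => (iter_f_ne_none_iff B hi hin _ _).1 hk⟩

/-- The one-point crystal of weight `0`, that is, `𝐁^{⊗ 0}`. -/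
def unit (n : ℕ) : Crystal n where
  carrier := Unit
  wt _ := 0
  e _ _ := none
  f _ _ := none
  eps _ _ := 0
  phi _ _ := 0
  eOne _ := none
  fOne _ := none
  wt_e := by simp
  wt_f := by simp
  phi_eq := by intros; simp [hPair, kPair]
  f_iff_e := by simp
  eps_e := by simp
  phi_e := by simp
  eps_f := by simp
  phi_f := by simp
  eps_eq_zero := by simp
  phi_eq_zero := by simp
  wt_nonneg := by simp
  wt_eOne := by simp
  wt_fOne := by simp
  fOne_iff_eOne := by simp
  eOne_comm_e := by simp
  eOne_comm_f := by simp
  fOne_comm_e := by simp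
  fOne_comm_f := by simp
  eps_eOne := by simp
  phi_eOne := by simp

/-- `f̃_i` on the boxes: `i ↦ i + 1`, all other boxes go to `0`. -/
def boxF (n i : ℕ) (a : Letter n) : Option (Letter n) :=
  if h : a.1 = i ∧ i + 1 ≤ n then some ⟨i + 1, by omega⟩ else none

/-- `ẽ_i` on the boxes: `i + 1 ↦ i`, all other boxes go to `0`. -/
def boxE (n i : ℕ) (a : Letter n) : Option (Letter n) :=
  if h : a.1 = i + 1 ∧ 1 ≤ i then some ⟨i, by have := a.2; omega⟩ else none

theorem boxF_eq_some {n i : ℕ} {a b : Letter n} :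
    boxF n i a = some b ↔ a.1 = i ∧ b.1 = i + 1 := by
  unfold boxF
  have := b.2
  split <;> simp [Subtype.ext_iff] <;> omega

theorem boxE_eq_some {n i : ℕ} {a b : Letter n} :
    boxE n i a = some b ↔ a.1 = i + 1 ∧ b.1 = i := by
  unfold boxE
  have := b.2
  split <;> simp [Subtype.ext_iff] <;> omega

theorem boxF_eq_none {n i : ℕ} {a : Letter n} (hin : i < n) : boxF n i a = none ↔ a.1 ≠ i := by
  unfold boxF
  split <;> simp <;> omega

theorem boxE_eq_none {n i : ℕ} {a : Letter n} (hi : 1 ≤ i) : boxE n i a = none ↔ a.1 ≠ i + 1 := by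
  unfold boxE
  split <;> simp <;> omega

theorem boxF_comm {n i : ℕ} (h3 : 3 ≤ i) (g : Letter n → Option (Letter n))
    (hg : ∀ a b, g a = some b → a.1 ≤ 2 ∧ b.1 ≤ 2) (b : Letter n) :
    (boxF n i b).bind g = (g b).bind (boxF n i) := by
  have h1 : (boxF n i b).bind g = none := by
    rw [Option.bind_eq_none_iff]
    intro a ha
    rw [boxF_eq_some] at ha
    rcases h : g a with _ | c
    · rfl
    · have := hg _ _ h
      omega
  rw [h1, eq_comm, Option.bind_eq_none_iff]
  intro a ha
  have := hg _ _ ha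
  unfold boxF
  rw [dif_neg (by omega)]

theorem boxE_comm {n i : ℕ} (h3 : 3 ≤ i) (g : Letter n → Option (Letter n))
    (hg : ∀ a b, g a = some b → a.1 ≤ 2 ∧ b.1 ≤ 2) (b : Letter n) :
    (boxE n i b).bind g = (g b).bind (boxE n i) := by
  have h1 : (boxE n i b).bind g = none := by
    rw [Option.bind_eq_none_iff]
    intro a ha
    rw [boxE_eq_some] at ha
    rcases h : g a with _ | c
    · rfl
    · have := hg _ _ h
      omega
  rw [h1, eq_comm, Option.bind_eq_none_iff]
  intro a ha
  have := hg _ _ ha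
  unfold boxE
  rw [dif_neg (by omega)]

theorem boxE_one_le {n : ℕ} (a b : Letter n) (h : boxE n 1 a = some b) : a.1 ≤ 2 ∧ b.1 ≤ 2 := by
  rw [boxE_eq_some] at h; omega

theorem boxF_one_le {n : ℕ} (a b : Letter n) (h : boxF n 1 a = some b) : a.1 ≤ 2 ∧ b.1 ≤ 2 := by
  rw [boxF_eq_some] at h; omega

/-- The crystal `𝐁` of the vector representation: its elements are the boxes `1, …, n`, the box `a`
has weight `ε_a`, there is an `i`-arrow from `i` to `i + 1` for `1 ≤ i < n`, and there is an odd
arrow from `1` to `2`. -/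
def box (n : ℕ) : Crystal n where
  carrier := Letter n
  wt a := epsWt n a.1
  e := boxE n
  f := boxF n
  eps i a := if a.1 = i + 1 then 1 else 0
  phi i a := if a.1 = i then 1 else 0
  eOne := boxE n 1
  fOne := boxF n 1
  wt_e i _ _ b b' h := by
    rw [boxE_eq_some] at h
    rw [h.1, h.2, simpleRoot]; abel
  wt_f i _ _ b b' h := by
    rw [boxF_eq_some] at h
    rw [h.1, h.2, simpleRoot]; abel
  phi_eq i hi hin b := by
    rw [hPair, kPair_epsWt i _ hi (by omega), kPair_epsWt (i + 1) _ (by omega) (by omega)]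
    simp only [eq_comm (a := i), eq_comm (a := i + 1)]
    split_ifs <;> simp
  f_iff_e i _ _ b b' := by rw [boxF_eq_some, boxE_eq_some, and_comm]
  eps_e i _ _ b b' h := by rw [boxE_eq_some] at h; simp [h.1, h.2]
  phi_e i _ _ b b' h := by rw [boxE_eq_some] at h; simp [h.1, h.2]
  eps_f i _ _ b b' h := by rw [boxF_eq_some] at h; simp [h.1, h.2]
  phi_f i _ _ b b' h := by rw [boxF_eq_some] at h; simp [h.1, h.2]
  eps_eq_zero i hi _ b h := by rw [boxE_eq_none hi] at h; simp [h]
  phi_eq_zero i _ hin b h := by rw [boxF_eq_none hin] at h; simp [h]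
  wt_nonneg b a := by simp only [epsWt]; split <;> simp
  wt_eOne b b' h := by
    rw [boxE_eq_some] at h
    rw [h.1, h.2, simpleRoot]; abel
  wt_fOne b b' h := by
    rw [boxF_eq_some] at h
    rw [h.1, h.2, simpleRoot]; abel
  fOne_iff_eOne b b' := by rw [boxF_eq_some, boxE_eq_some, and_comm]
  eOne_comm_e i h3 _ b := boxE_comm h3 _ boxE_one_le b
  eOne_comm_f i h3 _ b := boxF_comm h3 _ boxE_one_le b
  fOne_comm_e i h3 _ b := boxE_comm h3 _ boxF_one_le b
  fOne_comm_f i h3 _ b := boxF_comm h3 _ boxF_one_le b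
  eps_eOne i h3 _ b b' h := by
    have := boxE_one_le _ _ h
    rw [if_neg (by omega), if_neg (by omega)]
  phi_eOne i h3 _ b b' h := by
    have := boxE_one_le _ _ h
    rw [if_neg (by omega), if_neg (by omega)]

section Tensor

variable (B₁ B₂ : Crystal n)

/-- `ẽ_i` on `B₁ ⊗ B₂`. -/
def tensorE (i : ℕ) (b : B₁.carrier × B₂.carrier) : Option (B₁.carrier × B₂.carrier) :=
  if B₂.eps i b.2 ≤ B₁.phi i b.1 then (B₁.e i b.1).map (fun x => (x, b.2))
  else (B₂.e i b.2).map (fun y => (b.1, y))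

/-- `f̃_i` on `B₁ ⊗ B₂`. -/
def tensorF (i : ℕ) (b : B₁.carrier × B₂.carrier) : Option (B₁.carrier × B₂.carrier) :=
  if B₂.eps i b.2 < B₁.phi i b.1 then (B₁.f i b.1).map (fun x => (x, b.2))
  else (B₂.f i b.2).map (fun y => (b.1, y))

/-- An odd operator on `B₁ ⊗ B₂`, given by the odd operators `g₁` on `B₁` and `g₂` on `B₂`: it acts
on the first factor if `⟨k_1, wt b₂⟩ = ⟨k_2, wt b₂⟩ = 0`, and on the second factor otherwise. -/
def tensorOdd (g₁ : B₁.carrier → Option B₁.carrier) (g₂ : B₂.carrier → Option B₂.carrier)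
    (b : B₁.carrier × B₂.carrier) : Option (B₁.carrier × B₂.carrier) :=
  if kPair 1 (B₂.wt b.2) = 0 ∧ kPair 2 (B₂.wt b.2) = 0 then (g₁ b.1).map (fun x => (x, b.2))
  else (g₂ b.2).map (fun y => (b.1, y))

theorem tensorE_eq_some {i : ℕ} {b b' : B₁.carrier × B₂.carrier} :
    tensorE B₁ B₂ i b = some b' ↔
      (B₂.eps i b.2 ≤ B₁.phi i b.1 ∧ B₁.e i b.1 = some b'.1 ∧ b'.2 = b.2) ∨
      (B₁.phi i b.1 < B₂.eps i b.2 ∧ B₂.e i b.2 = some b'.2 ∧ b'.1 = b.1) := by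
  obtain ⟨b1, b2⟩ := b
  obtain ⟨c1, c2⟩ := b'
  unfold tensorE
  split
  next h => simp [h, Nat.not_lt.2 h, eq_comm (a := c2)]
  next h => simp [h, Nat.not_le.1 h, eq_comm (a := c1), and_comm]

theorem tensorF_eq_some {i : ℕ} {b b' : B₁.carrier × B₂.carrier} :
    tensorF B₁ B₂ i b = some b' ↔
      (B₂.eps i b.2 < B₁.phi i b.1 ∧ B₁.f i b.1 = some b'.1 ∧ b'.2 = b.2) ∨
      (B₁.phi i b.1 ≤ B₂.eps i b.2 ∧ B₂.f i b.2 = some b'.2 ∧ b'.1 = b.1) := by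
  obtain ⟨b1, b2⟩ := b
  obtain ⟨c1, c2⟩ := b'
  unfold tensorF
  split
  next h => simp [h, Nat.not_le.2 h, eq_comm (a := c2)]
  next h => simp [h, Nat.not_lt.1 h, eq_comm (a := c1), and_comm]

theorem tensorOdd_eq_some {g₁ : B₁.carrier → Option B₁.carrier}
    {g₂ : B₂.carrier → Option B₂.carrier} {b b' : B₁.carrier × B₂.carrier} :
    tensorOdd B₁ B₂ g₁ g₂ b = some b' ↔
      ((kPair 1 (B₂.wt b.2) = 0 ∧ kPair 2 (B₂.wt b.2) = 0) ∧ g₁ b.1 = some b'.1 ∧ b'.2 = b.2) ∨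
      (¬ (kPair 1 (B₂.wt b.2) = 0 ∧ kPair 2 (B₂.wt b.2) = 0) ∧
        g₂ b.2 = some b'.2 ∧ b'.1 = b.1) := by
  obtain ⟨b1, b2⟩ := b
  obtain ⟨c1, c2⟩ := b'
  unfold tensorOdd
  split
  next h => simp [h, eq_comm (a := c2)]
  next h => simp only [h]; simp [eq_comm (a := c1), and_comm]

theorem kPair_simpleRoot (hn : 2 ≤ n) (i : ℕ) (hi : i = 1 ∨ 3 ≤ i) :
    kPair 1 (simpleRoot n i) + kPair 2 (simpleRoot n i) = 0 := by
  rw [simpleRoot, kPair_sub, kPair_sub, kPair_epsWt 1 _ le_rfl (by omega),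
    kPair_epsWt 1 _ le_rfl (by omega), kPair_epsWt 2 _ (by omega) (by omega),
    kPair_epsWt 2 _ (by omega) (by omega)]
  rcases hi with rfl | hi
  · simp
  · rw [if_neg (by omega), if_neg (by omega), if_neg (by omega), if_neg (by omega)]; simp

/-- Moving by `α_1`, or by `α_i` with `i ≥ 3`, does not change whether
`⟨k_1, μ⟩ = ⟨k_2, μ⟩ = 0`, because the weights are non-negative. -/
theorem zero_iff_of_root (hn : 2 ≤ n) (B : Crystal n) (i : ℕ) (hi : i = 1 ∨ 3 ≤ i)
    (b b' : B.carrier)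
    (h : B.wt b' = B.wt b + simpleRoot n i ∨ B.wt b' = B.wt b - simpleRoot n i) :
    (kPair 1 (B.wt b') = 0 ∧ kPair 2 (B.wt b') = 0) ↔
      (kPair 1 (B.wt b) = 0 ∧ kPair 2 (B.wt b) = 0) := by
  have h0 := kPair_simpleRoot hn i hi
  have h1 := kPair_nonneg 1 _ (B.wt_nonneg b)
  have h2 := kPair_nonneg 2 _ (B.wt_nonneg b)
  have h3 := kPair_nonneg 1 _ (B.wt_nonneg b')
  have h4 := kPair_nonneg 2 _ (B.wt_nonneg b')
  have h5 : kPair 1 (B.wt b') + kPair 2 (B.wt b') = kPair 1 (B.wt b) + kPair 2 (B.wt b) := by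
    rcases h with h | h <;> rw [h]
    · rw [kPair_add, kPair_add]; omega
    · rw [kPair_sub, kPair_sub]; omega
  omega

/-- The index-free part of the commutation of an even and an odd operator on a tensor product. -/
theorem bind_comm_of_split {X Y : Type} (p q : X × Y → Prop) [DecidablePred p] [DecidablePred q]
    (a₁ c₁ : X → Option X) (a₂ c₂ : Y → Option Y)
    (h₁ : ∀ x, (a₁ x).bind c₁ = (c₁ x).bind a₁) (h₂ : ∀ y, (a₂ y).bind c₂ = (c₂ y).bind a₂)
    (hpa₁ : ∀ x y x', c₁ x = some x' → (p (x', y) ↔ p (x, y)))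
    (hpa₂ : ∀ x y y', c₂ y = some y' → (p (x, y') ↔ p (x, y)))
    (hqa₁ : ∀ x y x', a₁ x = some x' → (q (x', y) ↔ q (x, y)))
    (hqa₂ : ∀ x y y', a₂ y = some y' → (q (x, y') ↔ q (x, y))) (b : X × Y) :
    ((if p b then (a₁ b.1).map (fun x => (x, b.2)) else (a₂ b.2).map (fun y => (b.1, y))).bind
        fun d => if q d then (c₁ d.1).map (fun x => (x, d.2)) else (c₂ d.2).map (fun y => (d.1, y)))
      = (if q b then (c₁ b.1).map (fun x => (x, b.2)) else (c₂ b.2).map (fun y => (b.1, y))).bind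
        fun d => if p d then (a₁ d.1).map (fun x => (x, d.2))
          else (a₂ d.2).map (fun y => (d.1, y)) := by
  obtain ⟨x, y⟩ := b
  have h₁ := h₁ x
  have h₂ := h₂ y
  by_cases hp : p (x, y) <;> by_cases hq : q (x, y) <;> simp only [hp, hq, if_true, if_false] <;>
    rcases ha₁ : a₁ x with _ | x₁ <;> rcases ha₂ : a₂ y with _ | y₁ <;>
    rcases hc₁ : c₁ x with _ | x₂ <;> rcases hc₂ : c₂ y with _ | y₂ <;>
    simp only [ha₁, ha₂, hc₁, hc₂, Option.bind_none, Option.bind_some, Option.map_none,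
      Option.map_some] at h₁ h₂ ⊢ <;>
    grind

/-- The commutation of an even and an odd operator on a tensor product, for `i ≥ 3`. -/
theorem tensorOdd_comm_tensorE (hn : 2 ≤ n) {i : ℕ} (h3 : 3 ≤ i) (hin : i < n)
    (g₁ : B₁.carrier → Option B₁.carrier) (g₂ : B₂.carrier → Option B₂.carrier)
    (hc₁ : ∀ b, (B₁.e i b).bind g₁ = (g₁ b).bind (B₁.e i))
    (hc₂ : ∀ b, (B₂.e i b).bind g₂ = (g₂ b).bind (B₂.e i))
    (hphi : ∀ b b', g₁ b = some b' → B₁.phi i b' = B₁.phi i b)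
    (heps : ∀ b b', g₂ b = some b' → B₂.eps i b' = B₂.eps i b)
    (b : B₁.carrier × B₂.carrier) :
    (tensorE B₁ B₂ i b).bind (tensorOdd B₁ B₂ g₁ g₂) =
      (tensorOdd B₁ B₂ g₁ g₂ b).bind (tensorE B₁ B₂ i) :=
  bind_comm_of_split (fun b => B₂.eps i b.2 ≤ B₁.phi i b.1)
    (fun b => kPair 1 (B₂.wt b.2) = 0 ∧ kPair 2 (B₂.wt b.2) = 0) _ _ _ _ hc₁ hc₂
    (fun x y x' h => by simp only [hphi _ _ h]) (fun x y y' h => by simp only [heps _ _ h])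
    (fun _ _ _ _ => Iff.rfl)
    (fun x y y' h => zero_iff_of_root hn B₂ i (Or.inr h3) y y'
      (Or.inl (B₂.wt_e i (by omega) hin _ _ h))) b

theorem tensorOdd_comm_tensorF (hn : 2 ≤ n) {i : ℕ} (h3 : 3 ≤ i) (hin : i < n)
    (g₁ : B₁.carrier → Option B₁.carrier) (g₂ : B₂.carrier → Option B₂.carrier)
    (hc₁ : ∀ b, (B₁.f i b).bind g₁ = (g₁ b).bind (B₁.f i))
    (hc₂ : ∀ b, (B₂.f i b).bind g₂ = (g₂ b).bind (B₂.f i))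
    (hphi : ∀ b b', g₁ b = some b' → B₁.phi i b' = B₁.phi i b)
    (heps : ∀ b b', g₂ b = some b' → B₂.eps i b' = B₂.eps i b)
    (b : B₁.carrier × B₂.carrier) :
    (tensorF B₁ B₂ i b).bind (tensorOdd B₁ B₂ g₁ g₂) =
      (tensorOdd B₁ B₂ g₁ g₂ b).bind (tensorF B₁ B₂ i) :=
  bind_comm_of_split (fun b => B₂.eps i b.2 < B₁.phi i b.1)
    (fun b => kPair 1 (B₂.wt b.2) = 0 ∧ kPair 2 (B₂.wt b.2) = 0) _ _ _ _ hc₁ hc₂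
    (fun x y x' h => by simp only [hphi _ _ h]) (fun x y y' h => by simp only [heps _ _ h])
    (fun _ _ _ _ => Iff.rfl)
    (fun x y y' h => zero_iff_of_root hn B₂ i (Or.inr h3) y y'
      (Or.inr (B₂.wt_f i (by omega) hin _ _ h))) b

theorem phi_fOne (B : Crystal n) {i : ℕ} (h3 : 3 ≤ i) (hin : i < n) (b b' : B.carrier)
    (h : B.fOne b = some b') : B.phi i b' = B.phi i b :=
  (B.phi_eOne i h3 hin _ _ ((B.fOne_iff_eOne _ _).1 h)).symm

theorem eps_fOne (B : Crystal n) {i : ℕ} (h3 : 3 ≤ i) (hin : i < n) (b b' : B.carrier)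
    (h : B.fOne b = some b') : B.eps i b' = B.eps i b :=
  (B.eps_eOne i h3 hin _ _ ((B.fOne_iff_eOne _ _).1 h)).symm

theorem tensor_f_iff_e {i : ℕ} (hi : 1 ≤ i) (hin : i < n) (b b' : B₁.carrier × B₂.carrier) :
    tensorF B₁ B₂ i b = some b' ↔ tensorE B₁ B₂ i b' = some b := by
  rw [tensorE_eq_some, tensorF_eq_some, B₁.f_iff_e i hi hin, B₂.f_iff_e i hi hin]
  constructor
  · rintro (⟨h1, h2, h3⟩ | ⟨h1, h2, h3⟩)
    · have := B₁.phi_e i hi hin _ _ h2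
      refine Or.inl ⟨?_, h2, h3.symm⟩
      rw [h3]; omega
    · have := B₂.eps_e i hi hin _ _ h2
      refine Or.inr ⟨?_, h2, h3.symm⟩
      rw [h3]; omega
  · rintro (⟨h1, h2, h3⟩ | ⟨h1, h2, h3⟩)
    · have := B₁.phi_e i hi hin _ _ h2
      refine Or.inl ⟨?_, h2, h3.symm⟩
      rw [h3]; omega
    · have := B₂.eps_e i hi hin _ _ h2
      refine Or.inr ⟨?_, h2, h3.symm⟩
      rw [h3]; omega

/-- The tensor product `B₁ ⊗ B₂` of abstract `q(n)`-crystals. In the usual notation,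
`ε_i(b₁ ⊗ b₂) = max (ε_i(b₁), ε_i(b₂) - ⟨h_i, wt b₁⟩)` and
`φ_i(b₁ ⊗ b₂) = max (φ_i(b₂), φ_i(b₁) + ⟨h_i, wt b₂⟩)`; with `φ_i = ε_i + ⟨h_i, wt⟩` these are the
truncated differences below. -/
def tensor (hn : 2 ≤ n) (B₁ B₂ : Crystal n) : Crystal n where
  carrier := B₁.carrier × B₂.carrier
  wt b := B₁.wt b.1 + B₂.wt b.2
  e := tensorE B₁ B₂
  f := tensorF B₁ B₂
  eps i b := B₁.eps i b.1 + (B₂.eps i b.2 - B₁.phi i b.1)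
  phi i b := B₂.phi i b.2 + (B₁.phi i b.1 - B₂.eps i b.2)
  eOne := tensorOdd B₁ B₂ B₁.eOne B₂.eOne
  fOne := tensorOdd B₁ B₂ B₁.fOne B₂.fOne
  wt_e i hi hin b b' h := by
    rw [tensorE_eq_some] at h
    rcases h with ⟨-, h, h'⟩ | ⟨-, h, h'⟩
    · rw [h', B₁.wt_e i hi hin _ _ h]; abel
    · rw [h', B₂.wt_e i hi hin _ _ h]; abel
  wt_f i hi hin b b' h := by
    rw [tensorF_eq_some] at h
    rcases h with ⟨-, h, h'⟩ | ⟨-, h, h'⟩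
    · rw [h', B₁.wt_f i hi hin _ _ h]; abel
    · rw [h', B₂.wt_f i hi hin _ _ h]; abel
  phi_eq i hi hin b := by
    have h1 := B₁.phi_eq i hi hin b.1
    have h2 := B₂.phi_eq i hi hin b.2
    rw [hPair_add]
    omega
  f_iff_e i hi hin b b' := tensor_f_iff_e B₁ B₂ hi hin b b'
  eps_e i hi hin b b' h := by
    rw [tensorE_eq_some] at h
    rcases h with ⟨h0, h, h'⟩ | ⟨h0, h, h'⟩
    · have h1 := B₁.eps_e i hi hin _ _ h
      have h2 := B₁.phi_e i hi hin _ _ h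
      rw [h']; omega
    · have h1 := B₂.eps_e i hi hin _ _ h
      have h2 := B₂.phi_e i hi hin _ _ h
      rw [h']; omega
  phi_e i hi hin b b' h := by
    rw [tensorE_eq_some] at h
    rcases h with ⟨h0, h, h'⟩ | ⟨h0, h, h'⟩
    · have h1 := B₁.eps_e i hi hin _ _ h
      have h2 := B₁.phi_e i hi hin _ _ h
      rw [h']; omega
    · have h1 := B₂.eps_e i hi hin _ _ h
      have h2 := B₂.phi_e i hi hin _ _ h
      rw [h']; omega
  eps_f i hi hin b b' h := by
    rw [tensorF_eq_some] at h
    rcases h with ⟨h0, h, h'⟩ | ⟨h0, h, h'⟩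
    · have h1 := B₁.eps_f i hi hin _ _ h
      have h2 := B₁.phi_f i hi hin _ _ h
      rw [h']; omega
    · have h1 := B₂.eps_f i hi hin _ _ h
      have h2 := B₂.phi_f i hi hin _ _ h
      rw [h']; omega
  phi_f i hi hin b b' h := by
    rw [tensorF_eq_some] at h
    rcases h with ⟨h0, h, h'⟩ | ⟨h0, h, h'⟩
    · have h1 := B₁.eps_f i hi hin _ _ h
      have h2 := B₁.phi_f i hi hin _ _ h
      rw [h']; omega
    · have h1 := B₂.eps_f i hi hin _ _ h
      have h2 := B₂.phi_f i hi hin _ _ h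
      rw [h']; omega
  eps_eq_zero i hi hin b h := by
    unfold tensorE at h
    split at h
    · have := B₁.eps_eq_zero i hi hin b.1 (by simpa using h)
      omega
    · have := B₂.eps_eq_zero i hi hin b.2 (by simpa using h)
      omega
  phi_eq_zero i hi hin b h := by
    unfold tensorF at h
    split at h
    · have := B₁.phi_eq_zero i hi hin b.1 (by simpa using h)
      omega
    · have := B₂.phi_eq_zero i hi hin b.2 (by simpa using h)
      omega
  wt_nonneg b a := add_nonneg (B₁.wt_nonneg b.1 a) (B₂.wt_nonneg b.2 a)
  wt_eOne b b' h := by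
    rw [tensorOdd_eq_some] at h
    rcases h with ⟨-, h, h'⟩ | ⟨-, h, h'⟩
    · rw [h', B₁.wt_eOne _ _ h]; abel
    · rw [h', B₂.wt_eOne _ _ h]; abel
  wt_fOne b b' h := by
    rw [tensorOdd_eq_some] at h
    rcases h with ⟨-, h, h'⟩ | ⟨-, h, h'⟩
    · rw [h', B₁.wt_fOne _ _ h]; abel
    · rw [h', B₂.wt_fOne _ _ h]; abel
  fOne_iff_eOne b b' := by
    rw [tensorOdd_eq_some, tensorOdd_eq_some, B₁.fOne_iff_eOne, B₂.fOne_iff_eOne]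
    refine or_congr ⟨?_, ?_⟩ ⟨?_, ?_⟩
    · rintro ⟨h1, h2, h3⟩; exact ⟨by rwa [h3], h2, h3.symm⟩
    · rintro ⟨h1, h2, h3⟩; exact ⟨by rwa [h3], h2, h3.symm⟩
    · rintro ⟨h1, h2, h3⟩
      exact ⟨by rwa [← zero_iff_of_root hn B₂ 1 (Or.inl rfl) _ _ (Or.inl (B₂.wt_eOne _ _ h2))],
        h2, h3.symm⟩
    · rintro ⟨h1, h2, h3⟩
      exact ⟨by rwa [zero_iff_of_root hn B₂ 1 (Or.inl rfl) _ _ (Or.inl (B₂.wt_eOne _ _ h2))],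
        h2, h3.symm⟩
  eOne_comm_e i h3 hin := tensorOdd_comm_tensorE B₁ B₂ hn h3 hin _ _ (B₁.eOne_comm_e i h3 hin)
    (B₂.eOne_comm_e i h3 hin) (B₁.phi_eOne i h3 hin) (B₂.eps_eOne i h3 hin)
  eOne_comm_f i h3 hin := tensorOdd_comm_tensorF B₁ B₂ hn h3 hin _ _ (B₁.eOne_comm_f i h3 hin)
    (B₂.eOne_comm_f i h3 hin) (B₁.phi_eOne i h3 hin) (B₂.eps_eOne i h3 hin)
  fOne_comm_e i h3 hin := tensorOdd_comm_tensorE B₁ B₂ hn h3 hin _ _ (B₁.fOne_comm_e i h3 hin)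
    (B₂.fOne_comm_e i h3 hin) (phi_fOne B₁ h3 hin) (eps_fOne B₂ h3 hin)
  fOne_comm_f i h3 hin := tensorOdd_comm_tensorF B₁ B₂ hn h3 hin _ _ (B₁.fOne_comm_f i h3 hin)
    (B₂.fOne_comm_f i h3 hin) (phi_fOne B₁ h3 hin) (eps_fOne B₂ h3 hin)
  eps_eOne i h3 hin b b' h := by
    rw [tensorOdd_eq_some] at h
    rcases h with ⟨-, h, h'⟩ | ⟨-, h, h'⟩
    · rw [h', B₁.eps_eOne i h3 hin _ _ h, B₁.phi_eOne i h3 hin _ _ h]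
    · rw [h', B₂.eps_eOne i h3 hin _ _ h]
  phi_eOne i h3 hin b b' h := by
    rw [tensorOdd_eq_some] at h
    rcases h with ⟨-, h, h'⟩ | ⟨-, h, h'⟩
    · rw [h', B₁.phi_eOne i h3 hin _ _ h]
    · rw [h', B₂.phi_eOne i h3 hin _ _ h, B₂.eps_eOne i h3 hin _ _ h]

end Tensor

/-- The tensor power `𝐁^{⊗ N} = 𝐁 ⊗ (𝐁 ⊗ (⋯))`, with `N` factors. -/
def tensorPow {n : ℕ} (hn : 2 ≤ n) : ℕ → Crystal n
  | 0 => unit n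
  | N + 1 => tensor hn (box n) (tensorPow hn N)

/-- The element `a ⊗ b` of `𝐁^{⊗ (N+1)}`, for a box `a` and `b ∈ 𝐁^{⊗ N}`. -/
def consBox {n : ℕ} (hn : 2 ≤ n) {N : ℕ} (a : Letter n) (b : (tensorPow hn N).carrier) :
    (tensorPow hn (N + 1)).carrier := (a, b)

section Weyl

variable (B : Crystal n)

theorem iter_f_isSome {i : ℕ} (h : 1 ≤ i ∧ i < n) (b : B.carrier) :
    (iter (B.f i) (hPair i (B.wt b)).toNat b).isSome := by
  have h0 := B.phi_eq i h.1 h.2 b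
  exact Option.isSome_iff_ne_none.2 ((iter_f_ne_none_iff B h.1 h.2 _ _).2 (by omega))

theorem iter_e_isSome {i : ℕ} (h : 1 ≤ i ∧ i < n) (b : B.carrier) :
    (iter (B.e i) (-hPair i (B.wt b)).toNat b).isSome := by
  have h0 := B.phi_eq i h.1 h.2 b
  exact Option.isSome_iff_ne_none.2 ((iter_e_ne_none_iff B h.1 h.2 _ _).2 (by omega))

/-- The automorphism `S_i`: `S_i b = f̃_i^{⟨h_i, wt b⟩} b` if `⟨h_i, wt b⟩ ≥ 0`, and
`S_i b = ẽ_i^{-⟨h_i, wt b⟩} b` if `⟨h_i, wt b⟩ ≤ 0`. Only the indices `1 ≤ i < n` matter. -/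
def S (i : ℕ) (b : B.carrier) : B.carrier :=
  if h : 1 ≤ i ∧ i < n then
    if 0 ≤ hPair i (B.wt b) then
      (iter (B.f i) (hPair i (B.wt b)).toNat b).get (iter_f_isSome B h b)
    else (iter (B.e i) (-hPair i (B.wt b)).toNat b).get (iter_e_isSome B h b)
  else b

/-- The composition `S_{i_1} ∘ ⋯ ∘ S_{i_r}`, which is `S_w` for `w = s_{i_1} ⋯ s_{i_r}`. -/
def SWord (l : List ℕ) (b : B.carrier) : B.carrier := l.foldr (fun i x => B.S i x) b

/-- The word `2, …, i, 1, …, i - 1` of `w_i = s_2 ⋯ s_i s_1 ⋯ s_{i-1}`, for `i ≥ 1`. -/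
def wWord (i : ℕ) : List ℕ := List.Ico 2 (i + 1) ++ List.Ico 1 i

/-- The odd Kashiwara operator `ẽ_{ī} = S_{w_i^{-1}} ẽ_{1̄} S_{w_i}` for `1 ≤ i < n`
(where `w_1 = 1`). -/
def eOdd (i : ℕ) (b : B.carrier) : Option B.carrier :=
  (B.eOne (B.SWord (wWord i) b)).map (B.SWord (wWord i).reverse)

/-- `b` is a `gl(n)`-highest weight vector. -/
def IsGLHighest (b : B.carrier) : Prop := ∀ i, 1 ≤ i → i < n → B.e i b = none

/-- `b` is a (`q(n)`-)highest weight vector. -/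
def IsHighest (b : B.carrier) : Prop :=
  ∀ i, 1 ≤ i → i < n → B.e i b = none ∧ B.eOdd i b = none

/-- The element `f̃_1 f̃_2 ⋯ f̃_m b` of `B ⊔ {0}` (it is `b` for `m = 0`). -/
def fDown : ℕ → B.carrier → Option B.carrier
  | 0, b => some b
  | m + 1, b => (B.f (m + 1) b).bind (fDown m)

end Weyl

end Crystal

end QueerCrystal

/-! The even operators enter through two facts. A `gl(n)`-component has exactly one highest weight
vector h, and the extremal vectors S_w h are determined inside the component by their weights. Both
rest on Stembridge-type local relations (`IsRegular`), which survive tensoring with a box and make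
the raising operators confluent (`IsRegular.up_unique`). Hence a word of reflections acts on h only
through its permutation (`SWord_eq_SWord`), and no braid relation has to be checked. Moreover, an
extremal vector sits at an end of each of its k-strings, because no weight of the component is
longer than wt h.

Let λ = wt b, so that b₀ has weight λ + ε_j. The key identity is S_1⋯S_{j-1} b₀ = 1 ⊗ S_1⋯S_{j-1} b
(`IsRegular.SWord_boxCons_fDown`). The reflections S_k with k ≥ 3 do not affect whether ẽ_{1̄}
vanishes. Up to such factors on the left, each w_i is rewritten to end in s_1⋯s_{j-1}, and ẽ_{1̄}
S_{w_i} b₀ = 0 becomes a statement ẽ_{1̄}(x ⊗ y) = 0. Since ẽ_{1̄} acts on the rightmost letter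
among 1 and 2, it kills y too. Let v be S_{w_i} b, up to reflections S_k with k ≥ 3. If j ≤ i, then
y = v. If j = i + 1, then y = f̃_1 v, and ẽ_1 preserves the vanishing of ẽ_{1̄}. If j > i + 1, a
commutation along strings (`IsRegular.exists_f_string`) gives y = f̃_1 f̃_2 v. Removing f̃_2 needs
φ_2(v) ≥ 2, that is λ_{i+1} ≥ λ_j + 2. This holds because the weight of the `q(n)`-highest vector b₀
is a strict partition (`IsHighest.hPair_pos`). -/

namespace QueerCrystal
namespace Crystal
variable {n : ℕ}

/-! ### Local relations between raising operators and their stability under tensoring with a box. -/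

/-- Local (Stembridge type) conditions on the even raising operators of a crystal. -/
structure IsRegular (B : Crystal n) : Prop where
  far_eps : ∀ i k, 1 ≤ i → i < n → 1 ≤ k → k < n → (i + 2 ≤ k ∨ k + 2 ≤ i) →
    ∀ y y', B.e i y = some y' → B.eps k y' = B.eps k y
  far_comm : ∀ i k, 1 ≤ i → i < n → 1 ≤ k → k < n → (i + 2 ≤ k ∨ k + 2 ≤ i) →
    ∀ y y₁ y₂, B.e i y = some y₁ → B.e k y = some y₂ → B.e k y₁ = B.e i y₂
  step : ∀ i k, 1 ≤ i → i < n → 1 ≤ k → k < n → (k = i + 1 ∨ i = k + 1) →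
    ∀ y y', B.e i y = some y' → B.eps k y' = B.eps k y ∨ B.eps k y' = B.eps k y + 1
  -- Confluence does not use `convex` and `mixed`; they are what lets `octagon` pass to the tensor
  -- product with a box.
  convex : ∀ i k, 1 ≤ i → i < n → 1 ≤ k → k < n → (k = i + 1 ∨ i = k + 1) →
    ∀ y y' y'', B.e i y = some y' → B.e i y' = some y'' → B.eps k y' = B.eps k y + 1 →
      B.eps k y'' = B.eps k y' + 1
  mixed : ∀ i k, 1 ≤ i → i < n → 1 ≤ k → k < n → (k = i + 1 ∨ i = k + 1) →
    ∀ y y' w, B.e i y = some y' → B.eps k y' = B.eps k y + 1 → B.e k y' = some w →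
      B.eps i w = B.eps i y'
  square : ∀ i k, 1 ≤ i → i < n → 1 ≤ k → k < n → (k = i + 1 ∨ i = k + 1) →
    ∀ y y₁ y₂, B.e i y = some y₁ → B.e k y = some y₂ → B.eps k y₁ = B.eps k y →
      B.e k y₁ = B.e i y₂
  octagon : ∀ i k, 1 ≤ i → i < n → 1 ≤ k → k < n → k = i + 1 →
    ∀ y y₁ y₂, B.e i y = some y₁ → B.e k y = some y₂ → B.eps k y₁ = B.eps k y + 1 →
      B.eps i y₂ = B.eps i y + 1 →
      ∃ y₁₁ y₁₂ y₂₁ y₂₂ z, B.e k y₁ = some y₁₁ ∧ B.e k y₁₁ = some y₁₂ ∧ B.e i y₁₂ = some z ∧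
        B.e i y₂ = some y₂₁ ∧ B.e i y₂₁ = some y₂₂ ∧ B.e k y₂₂ = some z

theorem e_isSome_iff (B : Crystal n) {i : ℕ} (hi : 1 ≤ i) (hin : i < n) (b : B.carrier) :
    (∃ b', B.e i b = some b') ↔ 0 < B.eps i b := by
  constructor
  · rintro ⟨b', h⟩
    have := B.eps_e i hi hin _ _ h
    omega
  · intro h
    rcases hb : B.e i b with _ | b'
    · have := B.eps_eq_zero i hi hin _ hb
      omega
    · exact ⟨b', rfl⟩

theorem f_isSome_iff (B : Crystal n) {i : ℕ} (hi : 1 ≤ i) (hin : i < n) (b : B.carrier) :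
    (∃ b', B.f i b = some b') ↔ 0 < B.phi i b := by
  constructor
  · rintro ⟨b', h⟩
    have := B.phi_f i hi hin _ _ h
    omega
  · intro h
    rcases hb : B.f i b with _ | b'
    · have := B.phi_eq_zero i hi hin _ hb
      omega
    · exact ⟨b', rfl⟩

/-- The element `x ⊗ y` of `𝐁 ⊗ B`. -/
def boxCons (hn : 2 ≤ n) {B : Crystal n} (x : Letter n) (y : B.carrier) :
    (tensor hn (box n) B).carrier := (x, y)

theorem exists_boxCons {hn : 2 ≤ n} {B : Crystal n} (u : (tensor hn (box n) B).carrier) :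
    ∃ x y, u = boxCons hn x y := ⟨u.1, u.2, rfl⟩

theorem boxTensor_e (hn : 2 ≤ n) (B : Crystal n) {i : ℕ} (x x' : Letter n) (y y' : B.carrier) :
    (tensor hn (box n) B).e i (boxCons hn x y) = some (boxCons hn x' y') ↔
      (x' = x ∧ (if x.1 = i then 1 else 0) < B.eps i y ∧ B.e i y = some y') ∨
      (B.eps i y = 0 ∧ x.1 = i + 1 ∧ x'.1 = i ∧ y' = y) := by
  refine (tensorE_eq_some (box n) B).trans ?_
  simp only [box, boxE_eq_some, boxCons]
  constructor
  · rintro (⟨h1, ⟨h2, h3⟩, h4⟩ | ⟨h1, h2, h3⟩)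
    · right
      rw [if_neg (by omega)] at h1
      exact ⟨by omega, h2, h3, h4⟩
    · exact Or.inl ⟨h3, h1, h2⟩
  · rintro (⟨h1, h2, h3⟩ | ⟨h1, h2, h3, h4⟩)
    · exact Or.inr ⟨h2, h3, h1⟩
    · exact Or.inl ⟨by omega, ⟨h2, h3⟩, h4⟩

theorem boxTensor_eps (hn : 2 ≤ n) (B : Crystal n) (i : ℕ) (x : Letter n) (y : B.carrier) :
    (tensor hn (box n) B).eps i (boxCons hn x y) =
      (if x.1 = i + 1 then 1 else 0) + (B.eps i y - if x.1 = i then 1 else 0) := rfl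

section
variable {hn : 2 ≤ n} {B : Crystal n} (hB : B.IsRegular)
include hB

theorem IsRegular.boxTensor_far_eps (i k : ℕ) (hi : 1 ≤ i) (hin : i < n) (hk : 1 ≤ k) (hkn : k < n)
    (hik : i + 2 ≤ k ∨ k + 2 ≤ i) (y y' : (tensor hn (box n) B).carrier)
    (h : (tensor hn (box n) B).e i y = some y') :
    (tensor hn (box n) B).eps k y' = (tensor hn (box n) B).eps k y := by
  obtain ⟨x, y, rfl⟩ := exists_boxCons y
  obtain ⟨x', y', rfl⟩ := exists_boxCons y'
  rw [boxTensor_e] at h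
  rw [boxTensor_eps, boxTensor_eps]
  have := hB.far_eps i k hi hin hk hkn hik y y'
  grind

theorem IsRegular.boxTensor_step (i k : ℕ) (hi : 1 ≤ i) (hin : i < n) (hk : 1 ≤ k) (hkn : k < n)
    (hik : k = i + 1 ∨ i = k + 1) (y y' : (tensor hn (box n) B).carrier)
    (h : (tensor hn (box n) B).e i y = some y') :
    (tensor hn (box n) B).eps k y' = (tensor hn (box n) B).eps k y ∨
    (tensor hn (box n) B).eps k y' = (tensor hn (box n) B).eps k y + 1 := by
  obtain ⟨x, y, rfl⟩ := exists_boxCons y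
  obtain ⟨x', y', rfl⟩ := exists_boxCons y'
  rw [boxTensor_e] at h
  rw [boxTensor_eps, boxTensor_eps]
  have := hB.step i k hi hin hk hkn hik y y'
  grind

theorem IsRegular.boxTensor_convex (i k : ℕ) (hi : 1 ≤ i) (hin : i < n) (hk : 1 ≤ k) (hkn : k < n)
    (hik : k = i + 1 ∨ i = k + 1) (y y' y'' : (tensor hn (box n) B).carrier)
    (h : (tensor hn (box n) B).e i y = some y') (h' : (tensor hn (box n) B).e i y' = some y'')
    (h1 : (tensor hn (box n) B).eps k y' = (tensor hn (box n) B).eps k y + 1) :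
    (tensor hn (box n) B).eps k y'' = (tensor hn (box n) B).eps k y' + 1 := by
  obtain ⟨x, y, rfl⟩ := exists_boxCons y
  obtain ⟨x', y', rfl⟩ := exists_boxCons y'
  obtain ⟨x'', y'', rfl⟩ := exists_boxCons y''
  rw [boxTensor_e] at h h'
  rw [boxTensor_eps, boxTensor_eps] at h1
  rw [boxTensor_eps, boxTensor_eps]
  have := hB.step i k hi hin hk hkn hik y y'
  have := hB.step i k hi hin hk hkn hik y' y''
  have := hB.convex i k hi hin hk hkn hik y y' y''
  have := B.eps_e i hi hin y y'
  have := B.eps_e i hi hin y' y''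
  grind

theorem IsRegular.boxTensor_mixed (i k : ℕ) (hi : 1 ≤ i) (hin : i < n) (hk : 1 ≤ k) (hkn : k < n)
    (hik : k = i + 1 ∨ i = k + 1) (y y' w : (tensor hn (box n) B).carrier)
    (h : (tensor hn (box n) B).e i y = some y')
    (h1 : (tensor hn (box n) B).eps k y' = (tensor hn (box n) B).eps k y + 1)
    (h' : (tensor hn (box n) B).e k y' = some w) :
    (tensor hn (box n) B).eps i w = (tensor hn (box n) B).eps i y' := by
  obtain ⟨x, y, rfl⟩ := exists_boxCons y
  obtain ⟨x', y', rfl⟩ := exists_boxCons y'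
  obtain ⟨x'', w, rfl⟩ := exists_boxCons w
  rw [boxTensor_e] at h h'
  rw [boxTensor_eps, boxTensor_eps] at h1
  rw [boxTensor_eps, boxTensor_eps]
  have := hB.step i k hi hin hk hkn hik y y'
  have := hB.step k i hk hkn hi hin hik.symm y' w
  have := hB.mixed i k hi hin hk hkn hik y y' w
  have := B.eps_e i hi hin y y'
  have := B.eps_e k hk hkn y' w
  grind

theorem IsRegular.boxTensor_far_comm (i k : ℕ) (hi : 1 ≤ i) (hin : i < n) (hk : 1 ≤ k) (hkn : k < n)
    (hik : i + 2 ≤ k ∨ k + 2 ≤ i) (y y₁ y₂ : (tensor hn (box n) B).carrier)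
    (h : (tensor hn (box n) B).e i y = some y₁) (h' : (tensor hn (box n) B).e k y = some y₂) :
    (tensor hn (box n) B).e k y₁ = (tensor hn (box n) B).e i y₂ := by
  -- Once one side is known to be nonzero, the two sides can be compared coordinate by coordinate.
  have hpos : 0 < (tensor hn (box n) B).eps k y₁ := by
    rw [hB.boxTensor_far_eps i k hi hin hk hkn hik _ _ h, ← e_isSome_iff _ hk hkn]
    exact ⟨_, h'⟩
  obtain ⟨z, hz⟩ := (e_isSome_iff _ hk hkn _).2 hpos
  rw [hz, eq_comm]
  obtain ⟨x, y, rfl⟩ := exists_boxCons y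
  obtain ⟨x₁, y₁, rfl⟩ := exists_boxCons y₁
  obtain ⟨x₂, y₂, rfl⟩ := exists_boxCons y₂
  obtain ⟨xz, z, rfl⟩ := exists_boxCons z
  rw [boxTensor_e] at h h' hz ⊢
  have := hB.far_comm i k hi hin hk hkn hik y y₁ y₂
  have := hB.far_eps i k hi hin hk hkn hik y y₁
  have := hB.far_eps k i hk hkn hi hin hik.symm y y₂
  grind

theorem IsRegular.boxTensor_square (i k : ℕ) (hi : 1 ≤ i) (hin : i < n) (hk : 1 ≤ k) (hkn : k < n)
    (hik : k = i + 1 ∨ i = k + 1) (y y₁ y₂ : (tensor hn (box n) B).carrier)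
    (h : (tensor hn (box n) B).e i y = some y₁) (h' : (tensor hn (box n) B).e k y = some y₂)
    (h1 : (tensor hn (box n) B).eps k y₁ = (tensor hn (box n) B).eps k y) :
    (tensor hn (box n) B).e k y₁ = (tensor hn (box n) B).e i y₂ := by
  have hpos : 0 < (tensor hn (box n) B).eps k y₁ := by
    rw [h1, ← e_isSome_iff _ hk hkn]
    exact ⟨_, h'⟩
  obtain ⟨z, hz⟩ := (e_isSome_iff _ hk hkn _).2 hpos
  rw [hz, eq_comm]
  obtain ⟨x, y, rfl⟩ := exists_boxCons y
  obtain ⟨x₁, y₁, rfl⟩ := exists_boxCons y₁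
  obtain ⟨x₂, y₂, rfl⟩ := exists_boxCons y₂
  obtain ⟨xz, z, rfl⟩ := exists_boxCons z
  rw [boxTensor_eps, boxTensor_eps] at h1
  rw [boxTensor_e] at h h' hz ⊢
  have := hB.square i k hi hin hk hkn hik y y₁ y₂
  have := hB.step i k hi hin hk hkn hik y y₁
  have := hB.step k i hk hkn hi hin hik.symm y y₂
  have := B.eps_e i hi hin y y₁
  have := B.eps_e k hk hkn y y₂
  rcases h with h | h <;> rcases h' with h' | h' <;> rcases hz with hz | hz <;> grind

theorem IsRegular.boxTensor_octagon (i k : ℕ) (hi : 1 ≤ i) (hin : i < n) (hk : 1 ≤ k)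
    (hkn : k < n) (hik : k = i + 1) (y y₁ y₂ : (tensor hn (box n) B).carrier)
    (h : (tensor hn (box n) B).e i y = some y₁) (h' : (tensor hn (box n) B).e k y = some y₂)
    (h1 : (tensor hn (box n) B).eps k y₁ = (tensor hn (box n) B).eps k y + 1)
    (h2 : (tensor hn (box n) B).eps i y₂ = (tensor hn (box n) B).eps i y + 1) :
    ∃ y₁₁ y₁₂ y₂₁ y₂₂ z, (tensor hn (box n) B).e k y₁ = some y₁₁ ∧
      (tensor hn (box n) B).e k y₁₁ = some y₁₂ ∧ (tensor hn (box n) B).e i y₁₂ = some z ∧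
      (tensor hn (box n) B).e i y₂ = some y₂₁ ∧ (tensor hn (box n) B).e i y₂₁ = some y₂₂ ∧
      (tensor hn (box n) B).e k y₂₂ = some z := by
  have aux : ∀ i, 1 ≤ i → i < n → ∀ u, 0 < (tensor hn (box n) B).eps i u →
      ∃ v, (tensor hn (box n) B).e i u = some v :=
    fun i hi hin u hu => (e_isSome_iff _ hi hin u).2 hu
  have e1 := (tensor hn (box n) B).eps_e i hi hin _ _ h
  have e2 := (tensor hn (box n) B).eps_e k hk hkn _ _ h'
  obtain ⟨y₁₁, h₁₁⟩ := aux k hk hkn y₁ (by omega)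
  have e11 := (tensor hn (box n) B).eps_e k hk hkn _ _ h₁₁
  obtain ⟨y₁₂, h₁₂⟩ := aux k hk hkn y₁₁ (by omega)
  obtain ⟨y₂₁, h₂₁⟩ := aux i hi hin y₂ (by omega)
  have e21 := (tensor hn (box n) B).eps_e i hi hin _ _ h₂₁
  obtain ⟨y₂₂, h₂₂⟩ := aux i hi hin y₂₁ (by omega)
  refine ⟨y₁₁, y₁₂, y₂₁, y₂₂, ?_⟩
  -- The string lengths already provide both paths; only their meeting point is in question.
  suffices ∃ z, (tensor hn (box n) B).e i y₁₂ = some z ∧ (tensor hn (box n) B).e k y₂₂ = some z by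
    obtain ⟨z, hz, hz'⟩ := this
    exact ⟨z, h₁₁, h₁₂, hz, h₂₁, h₂₂, hz'⟩
  clear aux e11 e21 e1 e2
  obtain ⟨x, y, rfl⟩ := exists_boxCons y
  obtain ⟨x₁, y₁, rfl⟩ := exists_boxCons y₁
  obtain ⟨x₂, y₂, rfl⟩ := exists_boxCons y₂
  obtain ⟨x₁₁, y₁₁, rfl⟩ := exists_boxCons y₁₁
  obtain ⟨x₁₂, y₁₂, rfl⟩ := exists_boxCons y₁₂
  obtain ⟨x₂₁, y₂₁, rfl⟩ := exists_boxCons y₂₁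
  obtain ⟨x₂₂, y₂₂, rfl⟩ := exists_boxCons y₂₂
  rw [boxTensor_eps, boxTensor_eps] at h1 h2
  rw [boxTensor_e] at h h' h₁₁ h₁₂ h₂₁ h₂₂
  have ik : i ≠ k := by omega
  -- The operator e_i moves the box first. The moves left to the second factor form a square in `B`
  -- based at e_k y.
  by_cases hx1 : x.1 = i + 1 ∧ B.eps i y = 0
  · obtain ⟨-, hx1', hx1'', rfl⟩ : B.eps i y = 0 ∧ x.1 = i + 1 ∧ x₁.1 = i ∧ y₁ = y := by
      have := B.eps_e i hi hin y y₁
      grind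
    obtain ⟨rfl, hb, hy2⟩ : x₂ = x ∧ 1 < B.eps k y₁ ∧ B.e k y₁ = some y₂ := by
      grind
    obtain ⟨rfl, hy11⟩ : x₁₁ = x₁ ∧ y₁₁ = y₂ := by grind
    have hs : B.eps i y₁₁ = B.eps i y₁ + 1 := by grind
    obtain ⟨rfl, hy12⟩ : x₁₂ = x₁₁ ∧ B.e k y₁₁ = some y₁₂ := by grind
    obtain ⟨rfl, hy21⟩ : x₂₁ = x₂ ∧ B.e i y₁₁ = some y₂₁ := by grind
    have hs2 := hB.convex k i hk hkn hi hin (Or.inr hik) _ _ _ (hy11 ▸ hy2) hy12 hs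
    have hm := hB.mixed k i hk hkn hi hin (Or.inr hik) _ _ _ (hy11 ▸ hy2) hs hy21
    have hsq := hB.square i k hi hin hk hkn (Or.inl hik) _ _ _ hy21 hy12 hm
    obtain ⟨z, hz⟩ := (e_isSome_iff B hi hin y₁₂).2 (by omega)
    have h21 := B.eps_e i hi hin _ _ hy21
    have h12 := B.eps_e k hk hkn _ _ hy12
    have h22 : x₂₂.1 = i ∧ y₂₂ = y₂₁ := by grind
    refine ⟨boxCons hn x₁₂ z, ?_, ?_⟩
    · rw [boxTensor_e]; left; refine ⟨rfl, ?_, hz⟩; grind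
    · rw [boxTensor_e]; left; refine ⟨Subtype.ext (by omega), ?_, ?_⟩ <;> grind
  -- The operator e_k moves the box first. On the other path the second e_i may hit the box, now
  -- equal to k = i + 1, according to whether ε_i(y₁) vanishes.
  by_cases hx3 : x.1 = k + 1 ∧ B.eps k y = 0
  · obtain ⟨rfl, hy1⟩ : x₁ = x ∧ B.e i y = some y₁ := by grind
    obtain ⟨hx2, rfl⟩ : x₂.1 = k ∧ y₂ = y := by
      have := B.eps_e k hk hkn y y₂
      grind
    have hs : B.eps k y₁ = B.eps k y₂ + 1 := by grind
    obtain ⟨rfl, hy11⟩ : x₁₁ = x₁ ∧ B.e k y₁ = some y₁₁ := by grind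
    have hm := hB.mixed i k hi hin hk hkn (Or.inl hik) _ _ _ hy1 hs hy11
    have e11 := B.eps_e k hk hkn _ _ hy11
    have e1 := B.eps_e i hi hin _ _ hy1
    obtain ⟨hx12, rfl⟩ : x₁₂.1 = k ∧ y₁₂ = y₁₁ := by
      have := B.eps_e k hk hkn y₁₁ y₁₂
      grind
    obtain ⟨rfl, hy21⟩ : x₂₁ = x₂ ∧ y₂₁ = y₁ := by grind
    by_cases ha : B.eps i y₁ = 0
    · obtain ⟨hx22, rfl⟩ : x₂₂.1 = i ∧ y₂₂ = y₁ := by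
        have := B.eps_e i hi hin y₂₁ y₂₂
        grind
      refine ⟨boxCons hn x₂₂ y₁₂, ?_, ?_⟩
      · rw [boxTensor_e]; right; refine ⟨?_, ?_, ?_, rfl⟩ <;> omega
      · rw [boxTensor_e]; left; refine ⟨rfl, ?_, hy11⟩; grind
    · obtain ⟨rfl, hy22⟩ : x₂₂ = x₂₁ ∧ B.e i y₁ = some y₂₂ := by grind
      have hs2 := hB.convex i k hi hin hk hkn (Or.inl hik) _ _ _ hy1 hy22 hs
      have hsq := hB.square k i hk hkn hi hin (Or.inr hik) _ _ _ hy11 hy22 hm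
      obtain ⟨z, hz⟩ := (e_isSome_iff B hi hin y₁₂).2 (by omega)
      refine ⟨boxCons hn x₁₂ z, ?_, ?_⟩
      · rw [boxTensor_e]; left; refine ⟨rfl, ?_, hz⟩; grind
      · rw [boxTensor_e]; left; refine ⟨Subtype.ext (by omega), ?_, ?_⟩ <;> grind
  -- Both first moves act on the second factor; the box then stays fixed throughout and the octagon
  -- of `B` is copied.
  · obtain ⟨rfl, hy1⟩ : x₁ = x ∧ B.e i y = some y₁ := by grind
    obtain ⟨rfl, hy2⟩ : x₂ = x₁ ∧ B.e k y = some y₂ := by grind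
    have e1 := B.eps_e i hi hin _ _ hy1
    have e2 := B.eps_e k hk hkn _ _ hy2
    have s1 := hB.step i k hi hin hk hkn (Or.inl hik) _ _ hy1
    have s2 := hB.step k i hk hkn hi hin (Or.inr hik) _ _ hy2
    have hs1 : B.eps k y₁ = B.eps k y + 1 := by grind
    have hs2 : B.eps i y₂ = B.eps i y + 1 := by grind
    obtain ⟨z₁₁, z₁₂, z₂₁, z₂₂, z, g₁₁, g₁₂, gz, g₂₁, g₂₂, gz'⟩ :=
      hB.octagon i k hi hin hk hkn hik _ _ _ hy1 hy2 hs1 hs2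
    have m1 := hB.mixed i k hi hin hk hkn (Or.inl hik) _ _ _ hy1 hs1 g₁₁
    have m2 := hB.mixed k i hk hkn hi hin (Or.inr hik) _ _ _ hy2 hs2 g₂₁
    have e11 := B.eps_e k hk hkn _ _ g₁₁
    have e12 := B.eps_e k hk hkn _ _ g₁₂
    have ez := B.eps_e i hi hin _ _ gz
    have e21 := B.eps_e i hi hin _ _ g₂₁
    have e22 := B.eps_e i hi hin _ _ g₂₂
    have ez' := B.eps_e k hk hkn _ _ gz'
    have t1 := hB.step k i hk hkn hi hin (Or.inr hik) _ _ g₁₂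
    have t2 := hB.step i k hi hin hk hkn (Or.inl hik) _ _ g₂₂
    have t3 := hB.step i k hi hin hk hkn (Or.inl hik) _ _ gz
    have t4 := hB.step k i hk hkn hi hin (Or.inr hik) _ _ gz'
    obtain ⟨rfl, rfl⟩ : x₁₁ = x₂ ∧ y₁₁ = z₁₁ := by grind
    obtain ⟨rfl, rfl⟩ : x₁₂ = x₁₁ ∧ y₁₂ = z₁₂ := by grind
    obtain ⟨rfl, rfl⟩ : x₂₁ = x₁₂ ∧ y₂₁ = z₂₁ := by grind
    obtain ⟨rfl, rfl⟩ : x₂₂ = x₂₁ ∧ y₂₂ = z₂₂ := by grind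
    refine ⟨boxCons hn x₂₂ z, ?_, ?_⟩
    · rw [boxTensor_e]; left; refine ⟨rfl, ?_, gz⟩; grind
    · rw [boxTensor_e]; left; refine ⟨rfl, ?_, gz'⟩; grind

theorem IsRegular.boxTensor : (tensor hn (box n) B).IsRegular where
  far_eps := hB.boxTensor_far_eps
  far_comm := hB.boxTensor_far_comm
  step := hB.boxTensor_step
  convex := hB.boxTensor_convex
  mixed := hB.boxTensor_mixed
  square := hB.boxTensor_square
  octagon := hB.boxTensor_octagon

end

theorem isRegular_unit : (unit n).IsRegular := by
  constructor <;> intros <;> simp_all [unit]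

theorem isRegular_tensorPow (hn : 2 ≤ n) (N : ℕ) : (tensorPow hn N).IsRegular := by
  induction N with
  | zero => exact isRegular_unit
  | succ N ih => exact ih.boxTensor

end Crystal

/-! ### Height and squared norm of weights. -/

section Weights

variable {n : ℕ}

theorem kPair_add_smul_simpleRoot {a k : ℕ} (ha : 1 ≤ a) (han : a ≤ n) (c : ℤ) (μ : Weight n) :
    kPair a (μ + c • simpleRoot n k) =
      kPair a μ + c * ((if a = k then 1 else 0) - if a = k + 1 then 1 else 0) := by
  have h : kPair a (c • simpleRoot n k) = c * kPair a (simpleRoot n k) := by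
    simp [kPair, ha, han]
  rw [kPair_add, h, simpleRoot, kPair_sub, kPair_epsWt a _ ha han, kPair_epsWt a _ ha han]

theorem weight_ext {μ ν : Weight n} (h : ∀ a, 1 ≤ a → a ≤ n → kPair a μ = kPair a ν) : μ = ν := by
  funext ⟨a, ha⟩
  simpa [kPair, ha] using h a ha.1 ha.2

/-- The height `∑ a μ_a` of a weight. -/
def height (μ : Weight n) : ℤ := ∑ a ∈ Finset.Icc 1 n, (a : ℤ) * kPair a μ

/-- The squared norm `∑ μ_a²` of a weight. -/
def sqNorm (μ : Weight n) : ℤ := ∑ a ∈ Finset.Icc 1 n, kPair a μ ^ 2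

theorem height_add_smul {k : ℕ} (hk : 1 ≤ k) (hkn : k < n) (c : ℤ) (μ : Weight n) :
    height (μ + c • simpleRoot n k) = height μ - c := by
  have h : ∀ a ∈ Finset.Icc 1 n, (a : ℤ) * kPair a (μ + c • simpleRoot n k) =
      (a : ℤ) * kPair a μ + ((if a = k then c * k else 0) - if a = k + 1 then c * (k + 1) else 0) := by
    intro a ha
    rw [Finset.mem_Icc] at ha
    rw [kPair_add_smul_simpleRoot ha.1 ha.2]
    split_ifs with h1 h2 <;> subst_vars <;> push_cast <;>
      first | (exfalso; omega) | ring
  rw [height, Finset.sum_congr rfl h, Finset.sum_add_distrib, Finset.sum_sub_distrib,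
    Finset.sum_ite_eq', Finset.sum_ite_eq', if_pos (by simp; omega), if_pos (by simp; omega), height]
  ring

theorem sqNorm_add_smul {k : ℕ} (hk : 1 ≤ k) (hkn : k < n) (c : ℤ) (μ : Weight n) :
    sqNorm (μ + c • simpleRoot n k) = sqNorm μ + 2 * c * hPair k μ + 2 * c ^ 2 := by
  have h : ∀ a ∈ Finset.Icc 1 n, kPair a (μ + c • simpleRoot n k) ^ 2 =
      kPair a μ ^ 2 + ((if a = k then 2 * c * kPair k μ + c ^ 2 else 0) +
        if a = k + 1 then - 2 * c * kPair (k + 1) μ + c ^ 2 else 0) := by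
    intro a ha
    rw [Finset.mem_Icc] at ha
    rw [kPair_add_smul_simpleRoot ha.1 ha.2]
    split_ifs with h1 h2 <;> subst_vars <;> first | (exfalso; omega) | ring
  rw [sqNorm, Finset.sum_congr rfl h, Finset.sum_add_distrib, Finset.sum_add_distrib,
    Finset.sum_ite_eq', Finset.sum_ite_eq', if_pos (by simp; omega), if_pos (by simp; omega), sqNorm,
    hPair]
  ring

theorem height_nonneg (μ : Weight n) (h : ∀ a, 0 ≤ μ a) : 0 ≤ height μ :=
  Finset.sum_nonneg fun a _ => mul_nonneg (by positivity) (kPair_nonneg a μ h)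

end Weights

/-! ### Iterates and the reflections S_k. -/

theorem iter_add {B : Type} (g : B → Option B) (p q : ℕ) (b : B) :
    iter g (p + q) b = (iter g p b).bind (iter g q) := by
  induction p generalizing b with
  | zero => simp [iter]
  | succ p ih =>
    rw [Nat.succ_add, iter, iter]
    rcases g b with _ | c
    · rfl
    · exact ih c

theorem iter_one {B : Type} (g : B → Option B) (b : B) : iter g 1 b = g b := by
  rw [iter]
  rcases g b with _ | c <;> rfl

theorem iter_succ' {B : Type} (g : B → Option B) (q : ℕ) (b : B) :
    iter g (q + 1) b = (iter g q b).bind g := by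
  rw [iter_add]
  congr 1
  funext c
  exact iter_one g c

namespace Crystal

variable {n : ℕ} (B : Crystal n)

theorem iter_f_iff_iter_e {k : ℕ} (hk : 1 ≤ k) (hkn : k < n) (q : ℕ) (b b' : B.carrier) :
    iter (B.f k) q b = some b' ↔ iter (B.e k) q b' = some b := by
  induction q generalizing b with
  | zero => simp [iter, eq_comm]
  | succ q ih =>
    rw [iter, iter_succ', Option.bind_eq_some_iff, Option.bind_eq_some_iff]
    refine exists_congr fun c => ?_
    rw [ih, B.f_iff_e k hk hkn, and_comm]

theorem wt_iter_e {k : ℕ} (hk : 1 ≤ k) (hkn : k < n) (q : ℕ) (b b' : B.carrier)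
    (h : iter (B.e k) q b = some b') : B.wt b' = B.wt b + (q : ℤ) • simpleRoot n k := by
  induction q generalizing b with
  | zero => simp_all [iter]
  | succ q ih =>
    rw [iter, Option.bind_eq_some_iff] at h
    obtain ⟨c, hc, h⟩ := h
    rw [ih c h, B.wt_e k hk hkn _ _ hc]
    push_cast
    rw [add_smul, one_smul]
    abel

theorem wt_iter_f {k : ℕ} (hk : 1 ≤ k) (hkn : k < n) (q : ℕ) (b b' : B.carrier)
    (h : iter (B.f k) q b = some b') : B.wt b' = B.wt b + (-(q : ℤ)) • simpleRoot n k := by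
  rw [iter_f_iff_iter_e B hk hkn] at h
  rw [wt_iter_e B hk hkn _ _ _ h, neg_smul]
  abel

theorem S_eq_of_iter_f {k : ℕ} (hk : 1 ≤ k) (hkn : k < n) {q : ℕ} {u v : B.carrier}
    (hq : hPair k (B.wt u) = q) (h : iter (B.f k) q u = some v) : B.S k u = v := by
  rw [S, dif_pos ⟨hk, hkn⟩, if_pos (by omega)]
  simp only [hq, Int.toNat_natCast, h, Option.get_some]

theorem S_eq_of_iter_e {k : ℕ} (hk : 1 ≤ k) (hkn : k < n) {q : ℕ} {u v : B.carrier}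
    (hq : hPair k (B.wt u) = -q) (h : iter (B.e k) q u = some v) : B.S k u = v := by
  -- For pairing 0 the definition of `S` takes the lowering branch, so the trivial iterate is
  -- treated apart.
  rcases Nat.eq_zero_or_pos q with rfl | hpos
  · exact S_eq_of_iter_f B hk hkn (q := 0) (by simpa using hq) (by simpa [iter] using h)
  · rw [S, dif_pos ⟨hk, hkn⟩, if_neg (by omega)]
    simp only [hq, neg_neg, Int.toNat_natCast, h, Option.get_some]

theorem S_spec {k : ℕ} (hk : 1 ≤ k) (hkn : k < n) (u : B.carrier) :
    (∃ q : ℕ, hPair k (B.wt u) = q ∧ iter (B.f k) q u = some (B.S k u)) ∨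
    (∃ q : ℕ, hPair k (B.wt u) = -q ∧ iter (B.e k) q u = some (B.S k u)) := by
  rw [S, dif_pos ⟨hk, hkn⟩]
  split_ifs with h
  · exact Or.inl ⟨(hPair k (B.wt u)).toNat, by omega, by simp⟩
  · exact Or.inr ⟨(-hPair k (B.wt u)).toNat, by omega, by simp⟩

theorem wt_S {k : ℕ} (hk : 1 ≤ k) (hkn : k < n) (u : B.carrier) :
    B.wt (B.S k u) = B.wt u + (-hPair k (B.wt u)) • simpleRoot n k := by
  rcases B.S_spec hk hkn u with ⟨q, hq, h⟩ | ⟨q, hq, h⟩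
  · rw [wt_iter_f B hk hkn _ _ _ h, hq]
  · rw [wt_iter_e B hk hkn _ _ _ h, hq, neg_neg]

theorem hPair_wt_S {k : ℕ} (hk : 1 ≤ k) (hkn : k < n) (u : B.carrier) :
    hPair k (B.wt (B.S k u)) = -hPair k (B.wt u) := by
  rw [wt_S B hk hkn]
  generalize hc : hPair k (B.wt u) = c
  rw [hPair, kPair_add_smul_simpleRoot hk (by omega),
    kPair_add_smul_simpleRoot (by omega) (by omega), ← hc, hPair]
  simp only [if_true, Nat.succ_ne_self, if_false, (Nat.succ_ne_self k).symm]
  ring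

theorem kPair_wt_S {k : ℕ} (hk : 1 ≤ k) (hkn : k < n) (u : B.carrier) {a : ℕ} (ha : 1 ≤ a)
    (han : a ≤ n) : kPair a (B.wt (B.S k u)) =
      kPair (if a = k then k + 1 else if a = k + 1 then k else a) (B.wt u) := by
  rw [wt_S B hk hkn, kPair_add_smul_simpleRoot ha han, hPair]
  split_ifs with h1 h2 <;> subst_vars <;> first | (exfalso; omega) | ring

theorem S_S {k : ℕ} (hk : 1 ≤ k) (hkn : k < n) (u : B.carrier) : B.S k (B.S k u) = u := by
  have hw := B.hPair_wt_S hk hkn u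
  rcases B.S_spec hk hkn u with ⟨q, hq, h⟩ | ⟨q, hq, h⟩
  · rw [iter_f_iff_iter_e B hk hkn] at h
    exact S_eq_of_iter_e B hk hkn (by omega) h
  · rw [← iter_f_iff_iter_e B hk hkn] at h
    exact S_eq_of_iter_f B hk hkn (by omega) h

/-! ### Confluence of the raising operators and components. -/

/-- `u` is moved to `v` by some sequence of even raising operators. -/
def Up (u v : B.carrier) : Prop :=
  Relation.ReflTransGen (fun u v => ∃ i, 1 ≤ i ∧ i < n ∧ B.e i u = some v) u v

variable {B}

theorem Up.of_e {k : ℕ} (hk : 1 ≤ k) (hkn : k < n) {u v w : B.carrier} (h : B.e k u = some v)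
    (hv : B.Up v w) : B.Up u w := Relation.ReflTransGen.head ⟨k, hk, hkn, h⟩ hv

theorem height_e {k : ℕ} (hk : 1 ≤ k) (hkn : k < n) {u v : B.carrier} (h : B.e k u = some v) :
    height (B.wt v) = height (B.wt u) - 1 := by
  rw [B.wt_e k hk hkn _ _ h, ← height_add_smul hk hkn 1, one_smul]

theorem Up.height_le {u v : B.carrier} (h : B.Up u v) :
    height (B.wt v) ≤ height (B.wt u) ∧ (height (B.wt v) = height (B.wt u) → v = u) := by
  induction h with
  | refl => simp
  | tail _ h ih =>
    obtain ⟨k, hk, hkn, h⟩ := h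
    have := height_e hk hkn h
    exact ⟨by omega, fun h' => by omega⟩

/-- Each raising operator lowers the height by 1, and heights are non-negative because weights are,
so raising terminates. -/
theorem height_induction {p : B.carrier → Prop}
    (h : ∀ u, (∀ v, height (B.wt v) < height (B.wt u) → p v) → p u) (u : B.carrier) : p u := by
  have key : ∀ m : ℕ, ∀ u, height (B.wt u) < m → p u := by
    intro m
    induction m with
    | zero =>
      intro u hu
      have := height_nonneg _ (B.wt_nonneg u)
      simp at hu
      omega
    | succ m ih =>
      intro u hu
      exact h u fun v hv => ih v (by push_cast at hu; omega)
  exact key ((height (B.wt u)).toNat + 1) u (by push_cast; omega)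

theorem exists_up (u : B.carrier) : ∃ v, B.Up u v ∧ B.IsGLHighest v := by
  induction u using height_induction with
  | h u ih =>
    by_cases hu : B.IsGLHighest u
    · exact ⟨u, .refl, hu⟩
    · simp only [IsGLHighest, not_forall] at hu
      obtain ⟨i, hi, hin, h⟩ := hu
      obtain ⟨v, hv⟩ := Option.ne_none_iff_exists'.1 h
      obtain ⟨w, hw, hw'⟩ := ih v (by have := height_e hi hin hv; omega)
      exact ⟨w, hw.of_e hi hin hv, hw'⟩

theorem IsRegular.local_confluence (hB : B.IsRegular) {i k : ℕ} (hi : 1 ≤ i) (hin : i < n)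
    (hk : 1 ≤ k) (hkn : k < n) {u v w : B.carrier} (h : B.e i u = some v) (h' : B.e k u = some w) :
    ∃ z, B.Up v z ∧ B.Up w z := by
  have up_of_eq : B.e k v = B.e i w → (∃ z, B.e k v = some z) → ∃ z, B.Up v z ∧ B.Up w z := by
    rintro h1 ⟨z, hz⟩
    exact ⟨z, Up.of_e hk hkn hz .refl, Up.of_e hi hin (h1 ▸ hz) .refl⟩
  have hu := (e_isSome_iff B hk hkn u).1 ⟨w, h'⟩
  have hu' := (e_isSome_iff B hi hin u).1 ⟨v, h⟩
  rcases lt_trichotomy i k with hlt | rfl | hlt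
  · by_cases hik : k = i + 1
    · rcases hB.step i k hi hin hk hkn (Or.inl hik) _ _ h with h1 | h1
      · exact up_of_eq (hB.square i k hi hin hk hkn (Or.inl hik) _ _ _ h h' h1)
          ((e_isSome_iff B hk hkn v).2 (by omega))
      rcases hB.step k i hk hkn hi hin (Or.inr hik) _ _ h' with h2 | h2
      · have := hB.square k i hk hkn hi hin (Or.inr hik) _ _ _ h' h h2
        exact up_of_eq this.symm ((e_isSome_iff B hk hkn v).2 (by omega))
      obtain ⟨_, _, _, _, z, h3, h4, h5, h6, h7, h8⟩ :=
        hB.octagon i k hi hin hk hkn hik _ _ _ h h' h1 h2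
      exact ⟨z, Up.of_e hk hkn h3 (Up.of_e hk hkn h4 (Up.of_e hi hin h5 .refl)),
        Up.of_e hi hin h6 (Up.of_e hi hin h7 (Up.of_e hk hkn h8 .refl))⟩
    · have hf := hB.far_eps i k hi hin hk hkn (Or.inl (by omega)) _ _ h
      exact up_of_eq (hB.far_comm i k hi hin hk hkn (Or.inl (by omega)) _ _ _ h h')
        ((e_isSome_iff B hk hkn v).2 (by omega))
  · rw [h] at h'
    cases h'
    exact ⟨v, .refl, .refl⟩
  · by_cases hik : i = k + 1
    · rcases hB.step i k hi hin hk hkn (Or.inr hik) _ _ h with h1 | h1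
      · exact up_of_eq (hB.square i k hi hin hk hkn (Or.inr hik) _ _ _ h h' h1)
          ((e_isSome_iff B hk hkn v).2 (by omega))
      rcases hB.step k i hk hkn hi hin (Or.inl hik) _ _ h' with h2 | h2
      · have := hB.square k i hk hkn hi hin (Or.inl hik) _ _ _ h' h h2
        exact up_of_eq this.symm ((e_isSome_iff B hk hkn v).2 (by omega))
      obtain ⟨_, _, _, _, z, h3, h4, h5, h6, h7, h8⟩ :=
        hB.octagon k i hk hkn hi hin hik _ _ _ h' h h2 h1
      exact ⟨z, Up.of_e hk hkn h6 (Up.of_e hk hkn h7 (Up.of_e hi hin h8 .refl)),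
        Up.of_e hi hin h3 (Up.of_e hi hin h4 (Up.of_e hk hkn h5 .refl))⟩
    · have hf := hB.far_eps i k hi hin hk hkn (Or.inr (by omega)) _ _ h
      exact up_of_eq (hB.far_comm i k hi hin hk hkn (Or.inr (by omega)) _ _ _ h h')
        ((e_isSome_iff B hk hkn v).2 (by omega))

theorem IsGLHighest.eq_of_up {u v : B.carrier} (hu : B.IsGLHighest u) (h : B.Up u v) : v = u := by
  rcases h.cases_head with h | ⟨w, ⟨i, hi, hin, h⟩, -⟩
  · exact h.symm
  · rw [hu i hi hin] at h
    cases h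

/-- Newman's lemma: local confluence together with termination. -/
theorem IsRegular.up_unique (hB : B.IsRegular) {u v w : B.carrier} (hv : B.Up u v)
    (hvh : B.IsGLHighest v) (hw : B.Up u w) (hwh : B.IsGLHighest w) : v = w := by
  induction u using height_induction generalizing v w with
  | h u ih =>
    rcases hv.cases_head with rfl | ⟨v', ⟨i, hi, hin, h⟩, hv'⟩
    · exact (hvh.eq_of_up hw).symm
    rcases hw.cases_head with rfl | ⟨w', ⟨k, hk, hkn, h'⟩, hw'⟩
    · exact hwh.eq_of_up hv
    obtain ⟨z, hz, hz'⟩ := hB.local_confluence hi hin hk hkn h h'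
    obtain ⟨t, ht, hth⟩ := exists_up z
    have hh := height_e hi hin h
    have hh' := height_e hk hkn h'
    exact (ih v' (by omega) hv' hvh (hz.trans ht) hth).trans
      (ih w' (by omega) (hz'.trans ht) hth hw' hwh)

section Component

variable (hB : B.IsRegular) {h : B.carrier} (hh : B.IsGLHighest h)

theorem Up.f {k : ℕ} (hk : 1 ≤ k) (hkn : k < n) {u v : B.carrier} (hu : B.Up u h)
    (hv : B.f k u = some v) : B.Up v h :=
  hu.of_e hk hkn ((B.f_iff_e k hk hkn _ _).1 hv)

theorem Up.iter_f {k : ℕ} (hk : 1 ≤ k) (hkn : k < n) {q : ℕ} {u v : B.carrier} (hu : B.Up u h)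
    (hv : iter (B.f k) q u = some v) : B.Up v h := by
  induction q generalizing u with
  | zero => simp_all [iter]
  | succ q ih =>
    rw [iter, Option.bind_eq_some_iff] at hv
    obtain ⟨c, hc, hv⟩ := hv
    exact ih (hu.f hk hkn hc) hv

include hB hh

/-- A highest vector above v is also above u, hence is h by uniqueness. So `Up · h` describes the
whole component of h, closed under raising, lowering and reflections. -/
theorem Up.e {k : ℕ} (hk : 1 ≤ k) (hkn : k < n) {u v : B.carrier} (hu : B.Up u h)
    (hv : B.e k u = some v) : B.Up v h := by
  obtain ⟨w, hw, hwh⟩ := exists_up v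
  rwa [← hB.up_unique (hw.of_e hk hkn hv) hwh hu hh]

theorem Up.iter_e {k : ℕ} (hk : 1 ≤ k) (hkn : k < n) {q : ℕ} {u v : B.carrier} (hu : B.Up u h)
    (hv : iter (B.e k) q u = some v) : B.Up v h := by
  induction q generalizing u with
  | zero => simp_all [iter]
  | succ q ih =>
    rw [iter, Option.bind_eq_some_iff] at hv
    obtain ⟨c, hc, hv⟩ := hv
    exact ih (hu.e hB hh hk hkn hc) hv

theorem Up.S {k : ℕ} (hk : 1 ≤ k) (hkn : k < n) {u : B.carrier} (hu : B.Up u h) :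
    B.Up (B.S k u) h := by
  rcases B.S_spec hk hkn u with ⟨q, -, hq⟩ | ⟨q, -, hq⟩
  · exact hu.iter_f hk hkn hq
  · exact hu.iter_e hB hh hk hkn hq

/-- If ⟨h_k, wt u⟩ ≥ 0, raising by e_k lengthens the weight. Otherwise S_k keeps its length. Either
way the height drops. -/
theorem Up.sqNorm_le {u : B.carrier} (hu : B.Up u h) : sqNorm (B.wt u) ≤ sqNorm (B.wt h) := by
  induction u using height_induction with
  | h u ih =>
    rcases hu.cases_head with rfl | ⟨v, ⟨k, hk, hkn, hv⟩, -⟩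
    · exact le_rfl
    by_cases hp : 0 ≤ hPair k (B.wt u)
    · have h1 := ih v (by have := height_e hk hkn hv; omega) (hu.e hB hh hk hkn hv)
      have h2 := sqNorm_add_smul hk hkn 1 (B.wt u)
      rw [one_smul, ← B.wt_e k hk hkn _ _ hv] at h2
      omega
    · have h1 := height_add_smul hk hkn (-hPair k (B.wt u)) (B.wt u)
      have h2 := sqNorm_add_smul hk hkn (-hPair k (B.wt u)) (B.wt u)
      rw [← wt_S B hk hkn] at h1 h2
      have h3 := ih (B.S k u) (by omega) (hu.S hB hh hk hkn)
      nlinarith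

end Component

theorem sqNorm_wt_S {k : ℕ} (hk : 1 ≤ k) (hkn : k < n) (u : B.carrier) :
    sqNorm (B.wt (B.S k u)) = sqNorm (B.wt u) := by
  rw [wt_S B hk hkn, sqNorm_add_smul hk hkn]
  ring

/-! ### Words of reflections and the permutations they induce. -/

/-- The words in the letters `1, …, n - 1`. -/
def IsWord (n : ℕ) (l : List ℕ) : Prop := ∀ k ∈ l, 1 ≤ k ∧ k < n

theorem SWord_cons (k : ℕ) (l : List ℕ) (u : B.carrier) :
    B.SWord (k :: l) u = B.S k (B.SWord l u) := rfl

theorem SWord_append (l l' : List ℕ) (u : B.carrier) :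
    B.SWord (l ++ l') u = B.SWord l (B.SWord l' u) := List.foldr_append

theorem isWord_cons {k : ℕ} {l : List ℕ} : IsWord n (k :: l) ↔ (1 ≤ k ∧ k < n) ∧ IsWord n l := by
  simp [IsWord]

theorem isWord_append {l l' : List ℕ} : IsWord n (l ++ l') ↔ IsWord n l ∧ IsWord n l' := by
  simp only [IsWord, List.mem_append, or_imp, forall_and]
  tauto

theorem isWord_reverse {l : List ℕ} : IsWord n l.reverse ↔ IsWord n l := by
  simp [IsWord]

theorem SWord_induction {p : B.carrier → Prop} {l : List ℕ} (hl : IsWord n l)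
    (hp : ∀ k, 1 ≤ k → k < n → ∀ u, p u → p (B.S k u)) {u : B.carrier} (hu : p u) :
    p (B.SWord l u) := by
  induction l with
  | nil => exact hu
  | cons k l ih =>
    rw [isWord_cons] at hl
    exact hp k hl.1.1 hl.1.2 _ (ih hl.2)

theorem SWord_reverse_SWord {l : List ℕ} (hl : IsWord n l) (u : B.carrier) :
    B.SWord l.reverse (B.SWord l u) = u := by
  induction l with
  | nil => rfl
  | cons k l ih =>
    rw [isWord_cons] at hl
    rw [List.reverse_cons, SWord_append, SWord_cons k l, SWord_cons k [],
      show B.SWord [] (B.S k (B.SWord l u)) = B.S k (B.SWord l u) from rfl,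
      S_S B hl.1.1 hl.1.2, ih hl.2]

/-- The index `a` moved by the letters of a word, from the left to the right, so that
`⟨k_a, wt (S_w u)⟩ = ⟨k_{act w a}, wt u⟩`. -/
def act : List ℕ → ℕ → ℕ
  | [], a => a
  | k :: l, a => act l (if a = k then k + 1 else if a = k + 1 then k else a)

theorem act_append (l l' : List ℕ) (a : ℕ) : act (l ++ l') a = act l' (act l a) := by
  induction l generalizing a with
  | nil => rfl
  | cons k l ih => exact ih _

theorem kPair_wt_SWord {l : List ℕ} (hl : IsWord n l) (u : B.carrier) {a : ℕ} (ha : 1 ≤ a)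
    (han : a ≤ n) : kPair a (B.wt (B.SWord l u)) = kPair (act l a) (B.wt u) := by
  induction l generalizing a with
  | nil => rfl
  | cons k l ih =>
    rw [isWord_cons] at hl
    rw [SWord_cons, kPair_wt_S B hl.1.1 hl.1.2 _ ha han, act, ih hl.2] <;> split_ifs <;> omega

theorem act_Ico {p q : ℕ} (hpq : p ≤ q) (a : ℕ) : act (List.Ico p q) a =
    if a = p then q else if p < a ∧ a ≤ q then a - 1 else a := by
  induction q, hpq using Nat.le_induction with
  | base =>
    rw [List.Ico.self_empty]
    simp only [act]
    split_ifs <;> omega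
  | succ q hq ih =>
    rw [List.Ico.succ_top hq, act_append, ih]
    simp only [act]
    split_ifs <;> omega

theorem isWord_Ico {p q : ℕ} (hp : 1 ≤ p) (hq : q ≤ n) : IsWord n (List.Ico p q) := by
  intro k hk
  rw [List.Ico.mem] at hk
  omega

/-! ### Extremal vectors. -/

section Extremal

variable (hB : B.IsRegular) {h : B.carrier} (hh : B.IsGLHighest h)
include hB hh

/-- Undoing the word carries u to a vector of the component with the weight of h. Every other vector
of the component has larger height, so this vector is h. -/
theorem SWord_eq_of_wt {l : List ℕ} (hl : IsWord n l) {u : B.carrier} (hu : B.Up u h)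
    (hw : B.wt u = B.wt (B.SWord l h)) : u = B.SWord l h := by
  have hr : IsWord n l.reverse := isWord_reverse.2 hl
  have h1 : B.Up (B.SWord l.reverse u) h :=
    SWord_induction (p := fun u => B.Up u h) hr (fun k hk hkn u hu => hu.S hB hh hk hkn) hu
  have h2 : B.wt (B.SWord l.reverse u) = B.wt h := by
    conv_rhs => rw [← SWord_reverse_SWord hl h]
    refine weight_ext fun a ha han => ?_
    rw [kPair_wt_SWord hr _ ha han, kPair_wt_SWord hr _ ha han, hw]
  have h3 := h1.height_le.2 (by rw [h2])
  conv_rhs => rw [h3]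
  have := SWord_reverse_SWord hr u
  rw [List.reverse_reverse] at this
  exact this.symm

theorem SWord_eq_SWord {l l' : List ℕ} (hl : IsWord n l) (hl' : IsWord n l')
    (hll : ∀ a, 1 ≤ a → a ≤ n → act l a = act l' a) : B.SWord l h = B.SWord l' h := by
  refine SWord_eq_of_wt hB hh hl' ?_ (weight_ext fun a ha han => ?_)
  · exact SWord_induction (p := fun u => B.Up u h) hl (fun k hk hkn u hu => hu.S hB hh hk hkn) .refl
  · rw [kPair_wt_SWord hl _ ha han, kPair_wt_SWord hl' _ ha han, hll a ha han]

/-- Raising against a non-negative pairing would produce a weight longer than wt h inside the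
component. -/
theorem e_SWord_eq_none {l : List ℕ} (hl : IsWord n l) {k : ℕ} (hk : 1 ≤ k) (hkn : k < n)
    (hp : 0 ≤ hPair k (B.wt (B.SWord l h))) : B.e k (B.SWord l h) = none := by
  by_contra hne
  obtain ⟨v, hv⟩ := Option.ne_none_iff_exists'.1 hne
  have hu : B.Up (B.SWord l h) h :=
    SWord_induction (p := fun u => B.Up u h) hl (fun k hk hkn u hu => hu.S hB hh hk hkn) .refl
  have hs : sqNorm (B.wt (B.SWord l h)) = sqNorm (B.wt h) :=
    SWord_induction (p := fun u => sqNorm (B.wt u) = sqNorm (B.wt h)) hl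
      (fun k hk hkn u hu => by rw [sqNorm_wt_S hk hkn, hu]) rfl
  have h1 := (hu.e hB hh hk hkn hv).sqNorm_le hB hh
  have h2 := sqNorm_add_smul hk hkn 1 (B.wt (B.SWord l h))
  rw [one_smul, ← B.wt_e k hk hkn _ _ hv] at h2
  omega

theorem f_SWord_eq_none {l : List ℕ} (hl : IsWord n l) {k : ℕ} (hk : 1 ≤ k) (hkn : k < n)
    (hp : hPair k (B.wt (B.SWord l h)) ≤ 0) : B.f k (B.SWord l h) = none := by
  by_contra hne
  obtain ⟨v, hv⟩ := Option.ne_none_iff_exists'.1 hne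
  have hu : B.Up (B.SWord l h) h :=
    SWord_induction (p := fun u => B.Up u h) hl (fun k hk hkn u hu => hu.S hB hh hk hkn) .refl
  have hs : sqNorm (B.wt (B.SWord l h)) = sqNorm (B.wt h) :=
    SWord_induction (p := fun u => sqNorm (B.wt u) = sqNorm (B.wt h)) hl
      (fun k hk hkn u hu => by rw [sqNorm_wt_S hk hkn, hu]) rfl
  have h1 := (hu.f hk hkn hv).sqNorm_le hB hh
  have h2 := sqNorm_add_smul hk hkn (-1) (B.wt (B.SWord l h))
  rw [neg_smul, one_smul, ← sub_eq_add_neg, ← B.wt_f k hk hkn _ _ hv] at h2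
  omega

end Extremal

end Crystal

/-! ### Reflections of a box tensored with a vector. -/

theorem iter_map {A C : Type} (g : A → Option A) (g' : C → Option C) (φ : A → C)
    (h : ∀ y, g' (φ y) = (g y).map φ) (q : ℕ) (y : A) :
    iter g' q (φ y) = (iter g q y).map φ := by
  induction q generalizing y with
  | zero => rfl
  | succ q ih =>
    rw [iter, iter, h]
    rcases g y with _ | c
    · rfl
    · exact ih c

namespace Crystal

variable {n : ℕ} {B : Crystal n}

section BoxTensor

variable {hn : 2 ≤ n}

theorem hPair_boxCons {k : ℕ} (hk : 1 ≤ k) (hkn : k < n) (x : Letter n) (y : B.carrier) :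
    hPair k ((tensor hn (box n) B).wt (boxCons hn x y)) =
      (if x.1 = k then 1 else 0) - (if x.1 = k + 1 then 1 else 0) + hPair k (B.wt y) := by
  refine (hPair_add _ _ _).trans ?_
  congr 1
  change hPair k (epsWt n x.1) = _
  rw [hPair, kPair_epsWt k _ hk (by omega), kPair_epsWt (k + 1) _ (by omega) (by omega)]
  simp only [eq_comm (a := k), eq_comm (a := k + 1)]

theorem f_boxCons {k : ℕ} (x : Letter n) (y : B.carrier) (h : x.1 ≠ k ∨ 0 < B.eps k y) :
    (tensor hn (box n) B).f k (boxCons hn x y) = (B.f k y).map (boxCons hn x) := by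
  refine if_neg ?_
  change ¬ (B.eps k y < if x.1 = k then 1 else 0)
  split_ifs <;> omega

theorem f_boxCons_self {k : ℕ} (x x' : Letter n) (y : B.carrier) (h : B.eps k y = 0)
    (hx : x.1 = k) (hx' : x'.1 = k + 1) :
    (tensor hn (box n) B).f k (boxCons hn x y) = some (boxCons hn x' y) := by
  refine (if_pos ?_).trans ?_
  · change B.eps k y < if x.1 = k then 1 else 0
    rw [if_pos hx]
    omega
  · change (boxF n k x).map _ = _
    rw [boxF_eq_some.2 ⟨hx, hx'⟩]
    rfl

theorem e_boxCons_of_lt {k : ℕ} (x : Letter n) (y : B.carrier)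
    (h : (if x.1 = k then 1 else 0) < B.eps k y) :
    (tensor hn (box n) B).e k (boxCons hn x y) = (B.e k y).map (boxCons hn x) :=
  if_neg (Nat.not_le.2 h)

theorem e_boxCons_of_le {k : ℕ} (x : Letter n) (y : B.carrier)
    (h : B.eps k y ≤ if x.1 = k then 1 else 0) :
    (tensor hn (box n) B).e k (boxCons hn x y) = (boxE n k x).map (fun x => boxCons hn x y) :=
  if_pos h

theorem e_boxCons {k : ℕ} (hk : 1 ≤ k) (hkn : k < n) (x : Letter n) (y : B.carrier)
    (h : x.1 ≠ k) (h' : x.1 ≠ k + 1) :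
    (tensor hn (box n) B).e k (boxCons hn x y) = (B.e k y).map (boxCons hn x) := by
  rcases Nat.eq_zero_or_pos (B.eps k y) with h0 | h0
  · rw [e_boxCons_of_le _ _ (by omega), (boxE_eq_none hk).2 h']
    rcases he : B.e k y with _ | z
    · rfl
    · have := B.eps_e k hk hkn _ _ he
      omega
  · exact e_boxCons_of_lt _ _ (by rwa [if_neg h])

theorem S_boxCons {k : ℕ} (hk : 1 ≤ k) (hkn : k < n) (x : Letter n) (y : B.carrier)
    (h : x.1 ≠ k) (h' : x.1 ≠ k + 1) :
    (tensor hn (box n) B).S k (boxCons hn x y) = boxCons hn x (B.S k y) := by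
  have hw := hPair_boxCons (hn := hn) hk hkn x y
  rw [if_neg h, if_neg h', sub_self, zero_add] at hw
  rcases B.S_spec hk hkn y with ⟨q, hq, hs⟩ | ⟨q, hq, hs⟩
  · refine S_eq_of_iter_f _ hk hkn (hw.trans hq) ?_
    rw [iter_map (B.f k) _ _ fun y => f_boxCons x y (Or.inl h), hs]
    rfl
  · refine S_eq_of_iter_e _ hk hkn (hw.trans hq) ?_
    rw [iter_map (B.e k) _ _ fun y => e_boxCons hk hkn x y h h', hs]
    rfl

theorem SWord_boxCons {l : List ℕ} (hl : IsWord n l) (x : Letter n) (y : B.carrier)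
    (h : ∀ k ∈ l, x.1 ≠ k ∧ x.1 ≠ k + 1) :
    (tensor hn (box n) B).SWord l (boxCons hn x y) = boxCons hn x (B.SWord l y) := by
  induction l with
  | nil => rfl
  | cons k l ih =>
    rw [isWord_cons] at hl
    have hk := h k List.mem_cons_self
    rw [SWord_cons, SWord_cons, ih hl.2 fun k hk => h k (List.mem_cons_of_mem _ hk),
      S_boxCons hl.1.1 hl.1.2 _ _ hk.1 hk.2]

/-- The vector y is at the top of its k-string, so the first lowering step moves the box and the
remaining φ_k(y) steps exhaust the string of y. -/
theorem S_boxCons_self {k : ℕ} (hk : 1 ≤ k) (hkn : k < n) (x x' : Letter n) (y : B.carrier)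
    (h : x.1 = k) (h' : x'.1 = k + 1) (hy : B.e k y = none) :
    (tensor hn (box n) B).S k (boxCons hn x y) = boxCons hn x' (B.S k y) := by
  have hw := hPair_boxCons (hn := hn) hk hkn x y
  rw [if_pos h, if_neg (by omega)] at hw
  have he := B.eps_eq_zero k hk hkn y hy
  have hp := B.phi_eq k hk hkn y
  have hs : iter (B.f k) (B.phi k y) y = some (B.S k y) := by
    rcases B.S_spec hk hkn y with ⟨q, hq, hs⟩ | ⟨q, hq, hs⟩
    · rwa [show B.phi k y = q by omega]
    · obtain rfl : q = 0 := by omega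
      rwa [show B.phi k y = 0 by omega]
  refine S_eq_of_iter_f _ hk hkn (q := B.phi k y + 1) (by rw [hw]; push_cast; omega) ?_
  rw [iter, f_boxCons_self x x' y he h h', Option.bind_some,
    iter_map (B.f k) _ _ fun y => f_boxCons x' y (Or.inl (by omega)), hs]
  rfl

theorem iter_e_boxCons_self {k : ℕ} (hk : 1 ≤ k) (hkn : k < n) (x : Letter n) (q : ℕ)
    (y y' : B.carrier) (hq : q < B.eps k y) (h : iter (B.e k) q y = some y') :
    iter ((tensor hn (box n) B).e k) q (boxCons hn x y) = some (boxCons hn x y') := by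
  induction q generalizing y with
  | zero => simp_all [iter]
  | succ q ih =>
    rw [iter, Option.bind_eq_some_iff] at h
    obtain ⟨c, hc, h⟩ := h
    have := B.eps_e k hk hkn _ _ hc
    rw [iter, e_boxCons_of_lt _ _ (by split_ifs <;> omega), hc]
    exact ih c (by omega) h

theorem iter_f_boxCons_self {k : ℕ} (hk : 1 ≤ k) (hkn : k < n) (x : Letter n) (q : ℕ)
    (y y' : B.carrier) (hq : 0 < B.eps k y) (h : iter (B.f k) q y = some y') :
    iter ((tensor hn (box n) B).f k) q (boxCons hn x y) = some (boxCons hn x y') := by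
  induction q generalizing y with
  | zero => simp_all [iter]
  | succ q ih =>
    rw [iter, Option.bind_eq_some_iff] at h
    obtain ⟨c, hc, h⟩ := h
    have := B.eps_f k hk hkn _ _ hc
    rw [iter, f_boxCons _ _ (Or.inr hq), hc]
    exact ih c (by omega) h

/-- The vector z is at the bottom of its k-string. The box k raises the pairing by 1, so S_k applies
one raising step fewer to z and stops just below S_k z. -/
theorem exists_S_boxCons_eq {k : ℕ} (hk : 1 ≤ k) (hkn : k < n) (x : Letter n) (z : B.carrier)
    (hx : x.1 = k) (hz : B.f k z = none) (hz' : hPair k (B.wt z) < 0) :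
    ∃ y, B.f k (B.S k z) = some y ∧
      (tensor hn (box n) B).S k (boxCons hn x z) = boxCons hn x y := by
  have hw := hPair_boxCons (hn := hn) hk hkn x z
  rw [if_pos hx, if_neg (by omega)] at hw
  have hp := B.phi_eq k hk hkn z
  rw [B.phi_eq_zero k hk hkn z hz] at hp
  rcases B.S_spec hk hkn z with ⟨q, hq, hs⟩ | ⟨q, hq, hs⟩
  · omega
  · obtain ⟨q, rfl⟩ : ∃ p, q = p + 1 := ⟨q - 1, by omega⟩
    rw [iter_succ', Option.bind_eq_some_iff] at hs
    obtain ⟨y, hy, hs⟩ := hs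
    refine ⟨y, (B.f_iff_e k hk hkn _ _).2 hs, S_eq_of_iter_e _ hk hkn (q := q) ?_
      (iter_e_boxCons_self hk hkn x q z y (by omega) hy)⟩
    rw [hw, hq]
    push_cast
    ring

end BoxTensor

/-! ### Commutation of lowering operators. -/

theorem hPair_add_smul_simpleRoot_adj {i k : ℕ} (hi : 1 ≤ i) (hin : i < n)
    (hik : k = i + 1 ∨ i = k + 1) (c : ℤ) (μ : Weight n) :
    hPair i (μ + c • simpleRoot n k) = hPair i μ - c := by
  rw [hPair, kPair_add_smul_simpleRoot hi (by omega),
    kPair_add_smul_simpleRoot (by omega) (by omega), hPair]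
  split_ifs <;> first | (exfalso; omega) | ring

theorem hPair_add_smul_simpleRoot_far {i k : ℕ} (hi : 1 ≤ i) (hin : i < n)
    (hik : i + 2 ≤ k ∨ k + 2 ≤ i) (c : ℤ) (μ : Weight n) :
    hPair i (μ + c • simpleRoot n k) = hPair i μ := by
  rw [hPair, kPair_add_smul_simpleRoot hi (by omega),
    kPair_add_smul_simpleRoot (by omega) (by omega), hPair]
  split_ifs <;> first | (exfalso; omega) | ring

theorem IsRegular.f_far_comm (hB : B.IsRegular) {i k : ℕ} (hi : 1 ≤ i) (hin : i < n) (hk : 1 ≤ k)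
    (hkn : k < n) (hik : i + 2 ≤ k ∨ k + 2 ≤ i) {u v w : B.carrier} (hv : B.f i u = some v)
    (hw : B.f k u = some w) : ∃ z, B.f k v = some z ∧ B.f i w = some z := by
  have hv' := (B.f_iff_e i hi hin _ _).1 hv
  have hw1 := hB.far_eps i k hi hin hk hkn hik _ _ hv'
  have hp := B.phi_eq k hk hkn u
  have hp' := B.phi_eq k hk hkn v
  rw [B.wt_e i hi hin _ _ hv', ← one_smul ℤ (simpleRoot n i),
    hPair_add_smul_simpleRoot_far hk hkn hik.symm] at hp
  obtain ⟨z, hz⟩ := (f_isSome_iff B hk hkn v).2 (by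
    have := (f_isSome_iff B hk hkn u).1 ⟨w, hw⟩
    omega)
  have hz' := (B.f_iff_e k hk hkn _ _).1 hz
  have h1 := hB.far_eps k i hk hkn hi hin hik.symm _ _ hz'
  have h2 := B.eps_e i hi hin _ _ hv'
  obtain ⟨z', h3⟩ := (e_isSome_iff B hi hin z).2 (by omega)
  have h4 := hB.far_comm k i hk hkn hi hin hik.symm _ _ _ hz' h3
  rw [hv', eq_comm, ← B.f_iff_e k hk hkn, hw] at h4
  cases h4
  exact ⟨z, hz, (B.f_iff_e i hi hin _ _).2 h3⟩

theorem IsRegular.f_iter_far_comm (hB : B.IsRegular) {i k : ℕ} (hi : 1 ≤ i) (hin : i < n)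
    (hk : 1 ≤ k) (hkn : k < n) (hik : i + 2 ≤ k ∨ k + 2 ≤ i) {q : ℕ} {u v w : B.carrier}
    (hv : B.f i u = some v) (hw : iter (B.f k) q u = some w) :
    ∃ z, iter (B.f k) q v = some z ∧ B.f i w = some z := by
  induction q generalizing u v with
  | zero => simp_all [iter]
  | succ q ih =>
    rw [iter, Option.bind_eq_some_iff] at hw
    obtain ⟨c, hc, hw⟩ := hw
    obtain ⟨d, hd, hd'⟩ := hB.f_far_comm hi hin hk hkn hik hv hc
    rw [iter, hd]
    exact ih hd' hw

theorem IsRegular.fDown_iter_comm (hB : B.IsRegular) {k : ℕ} (hkn : k < n) {p q : ℕ}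
    (hp : p + 2 ≤ k) {u v w : B.carrier} (hv : B.fDown p u = some v)
    (hw : iter (B.f k) q u = some w) :
    ∃ z, iter (B.f k) q v = some z ∧ B.fDown p w = some z := by
  induction p generalizing u w with
  | zero => simp_all [fDown]
  | succ p ih =>
    rw [fDown, Option.bind_eq_some_iff] at hv
    obtain ⟨c, hc, hv⟩ := hv
    obtain ⟨d, hd, hd'⟩ := hB.f_iter_far_comm (by omega) (by omega) (by omega) hkn
      (Or.inl (by omega)) hc hw
    rw [fDown, hd']
    exact ih (by omega) hv hd

/-- In short, f_i f_k^{s+1} h = f_k^s f_i f_k h when e_i h = e_k h = 0. Along the f_k-string of h,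
ε_i stays 0 and φ_i grows by 1 at each step. -/
theorem IsRegular.exists_f_string (hB : B.IsRegular) {i k : ℕ} (hi : 1 ≤ i) (hin : i < n)
    (hk : 1 ≤ k) (hkn : k < n) (hik : k = i + 1 ∨ i = k + 1) {h : B.carrier}
    (hhi : B.e i h = none) (hhk : B.e k h = none) (s : ℕ) {g : B.carrier}
    (hg : iter (B.f k) (s + 1) h = some g) :
    ∃ h' r' r, B.f k h = some h' ∧ B.f i h' = some r' ∧ B.f i g = some r ∧
      iter (B.f k) s r' = some r := by
  have key : ∀ s g, iter (B.f k) s h = some g → B.eps i g = 0 ∧ B.eps k g = s ∧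
      B.phi i g = B.phi i h + s := by
    intro s
    induction s with
    | zero =>
      intro g hg
      simp only [iter, Option.some.injEq] at hg
      subst hg
      exact ⟨B.eps_eq_zero i hi hin _ hhi, B.eps_eq_zero k hk hkn _ hhk, rfl⟩
    | succ s ih =>
      intro g hg
      rw [iter_succ', Option.bind_eq_some_iff] at hg
      obtain ⟨c, hc, hg⟩ := hg
      have hg' := (B.f_iff_e k hk hkn _ _).1 hg
      obtain ⟨h1, h2, h3⟩ := ih c hc
      have h4 := hB.step k i hk hkn hi hin hik.symm _ _ hg'
      have h5 := B.eps_e k hk hkn _ _ hg'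
      have h6 := B.phi_eq i hi hin c
      have h7 := B.phi_eq i hi hin g
      rw [B.wt_e k hk hkn _ _ hg', ← one_smul ℤ (simpleRoot n k),
        hPair_add_smul_simpleRoot_adj hi hin hik] at h6
      refine ⟨by omega, by omega, ?_⟩
      omega
  induction s generalizing g with
  | zero =>
    obtain ⟨-, -, h3⟩ := key _ _ hg
    obtain ⟨r, hr⟩ := (f_isSome_iff B hi hin g).2 (by omega)
    rw [zero_add, iter_one] at hg
    exact ⟨g, r, r, hg, hr, hr, rfl⟩
  | succ s ih =>
    obtain ⟨h1, h2, h3⟩ := key _ _ hg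
    obtain ⟨r, hr⟩ := (f_isSome_iff B hi hin g).2 (by omega)
    rw [iter_succ', Option.bind_eq_some_iff] at hg
    obtain ⟨c, hc, hg⟩ := hg
    obtain ⟨h', r', r₁, hh', hr', hr₁, hi₁⟩ := ih hc
    refine ⟨h', r', r, hh', hr', hr, ?_⟩
    rw [iter_succ', hi₁, Option.bind_some, B.f_iff_e k hk hkn]
    have hg' := (B.f_iff_e k hk hkn _ _).1 hg
    rw [B.f_iff_e i hi hin] at hr hr₁
    have h4 := hB.step i k hi hin hk hkn hik _ _ hr
    obtain ⟨y, hy⟩ := (e_isSome_iff B hk hkn r).2 (by omega)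
    rw [hy]
    have hsq : B.e i y = B.e k g := by
      rcases h4 with h4 | h4
      · exact (hB.square i k hi hin hk hkn hik _ _ _ hr hy h4).symm
      · rcases hB.step k i hk hkn hi hin hik.symm _ _ hy with h5 | h5
        · exact hB.square k i hk hkn hi hin hik.symm _ _ _ hy hr h5
        -- In the octagon case e_i would be nonzero on e_k² g, which lies on the f_k-string of h,
        -- where ε_i = 0.
        · exfalso
          obtain ⟨a, b, z, ha, hb, hz⟩ : ∃ a b z, B.e k g = some a ∧ B.e k a = some b ∧
              B.e i b = some z := by
            rcases hik with hik | hik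
            · obtain ⟨a, b, _, _, z, ha, hb, hz, -⟩ :=
                hB.octagon i k hi hin hk hkn hik _ _ _ hr hy h4 h5
              exact ⟨a, b, z, ha, hb, hz⟩
            · obtain ⟨_, _, a, b, z, -, -, -, ha, hb, hz⟩ :=
                hB.octagon k i hk hkn hi hin hik _ _ _ hy hr h5 h4
              exact ⟨a, b, z, ha, hb, hz⟩
          rw [hg'] at ha
          cases ha
          rw [iter_succ', Option.bind_eq_some_iff] at hc
          obtain ⟨d, hd, hc⟩ := hc
          rw [(B.f_iff_e k hk hkn _ _).1 hc] at hb
          cases hb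
          have := B.eps_e i hi hin _ _ hz
          have := (key _ _ hd).1
          omega
    rw [hg', ← B.f_iff_e i hi hin] at hsq
    rw [← B.f_iff_e i hi hin, hsq] at hr₁
    exact hr₁

/-! ### The odd operator on words. -/

section Words

variable {hn : 2 ≤ n}

/-- The weight `μ` does not involve `ε₁` and `ε₂`. -/
def NoOneTwo (μ : Weight n) : Prop := kPair 1 μ = 0 ∧ kPair 2 μ = 0

theorem eOne_boxCons_of_noOneTwo {x : Letter n} {y : B.carrier} (h : NoOneTwo (B.wt y)) :
    (tensor hn (box n) B).eOne (boxCons hn x y) = (boxE n 1 x).map (fun x => boxCons hn x y) :=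
  if_pos h

theorem eOne_boxCons {x : Letter n} {y : B.carrier} (h : ¬ NoOneTwo (B.wt y)) :
    (tensor hn (box n) B).eOne (boxCons hn x y) = (B.eOne y).map (boxCons hn x) :=
  if_neg h

theorem eOne_eq_none (hn : 2 ≤ n) {y : B.carrier} (h : NoOneTwo (B.wt y)) : B.eOne y = none := by
  by_contra hne
  obtain ⟨z, hz⟩ := Option.ne_none_iff_exists'.1 hne
  have h1 := kPair_nonneg 2 _ (B.wt_nonneg z)
  rw [B.wt_eOne _ _ hz, ← one_smul ℤ (simpleRoot n 1),
    kPair_add_smul_simpleRoot (by omega) hn, h.2] at h1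
  simp at h1

theorem noOneTwo_iff_of_e_one (hn : 2 ≤ n) {y y' : B.carrier} (h : B.e 1 y = some y') :
    NoOneTwo (B.wt y') ↔ NoOneTwo (B.wt y) :=
  zero_iff_of_root hn B 1 (Or.inl rfl) _ _ (Or.inl (B.wt_e 1 le_rfl hn _ _ h))

/-- On a word, ẽ_{1̄} acts on the rightmost letter among 1 and 2, and vanishes exactly when this
letter is a 1 or is absent. The property therefore passes to every right factor. -/
theorem eOne_eq_none_of_boxCons {x : Letter n} {y : B.carrier}
    (h : (tensor hn (box n) B).eOne (boxCons hn x y) = none) : B.eOne y = none := by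
  by_cases hy : NoOneTwo (B.wt y)
  · exact eOne_eq_none hn hy
  · rw [eOne_boxCons hy, Option.map_eq_none_iff] at h
    exact h

theorem eps_le_kPair (B : Crystal n) {k : ℕ} (hk : 1 ≤ k) (hkn : k < n) (y : B.carrier) :
    (B.eps k y : ℤ) ≤ kPair (k + 1) (B.wt y) := by
  obtain ⟨z, hz⟩ := Option.ne_none_iff_exists'.1
    ((iter_e_ne_none_iff B hk hkn (B.eps k y) y).2 le_rfl)
  have h1 := kPair_nonneg (k + 1) _ (B.wt_nonneg z)
  rw [wt_iter_e B hk hkn _ _ _ hz, kPair_add_smul_simpleRoot (by omega) (by omega)] at h1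
  simp at h1
  omega

theorem phi_le_kPair (B : Crystal n) {k : ℕ} (hk : 1 ≤ k) (hkn : k < n) (y : B.carrier) :
    (B.phi k y : ℤ) ≤ kPair k (B.wt y) := by
  have h1 := B.phi_eq k hk hkn y
  have h2 := eps_le_kPair B hk hkn y
  rw [hPair] at h1
  omega

/-- The operator ẽ_1 only turns a 2 into a 1, so a rightmost letter 1 among the letters 1 and 2
remains one. -/
theorem eOne_eq_none_of_e_one {N : ℕ} {z z' : (tensorPow hn N).carrier}
    (h : (tensorPow hn N).eOne z = none) (hz : (tensorPow hn N).e 1 z = some z') :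
    (tensorPow hn N).eOne z' = none := by
  induction N with
  | zero => rfl
  | succ N ih =>
    obtain ⟨x, y, rfl⟩ := exists_boxCons (B := tensorPow hn N) z
    obtain ⟨x', y', rfl⟩ := exists_boxCons (B := tensorPow hn N) z'
    have hz := (boxTensor_e hn (tensorPow hn N) x x' y y').1 hz
    by_cases hy : NoOneTwo ((tensorPow hn N).wt y)
    · have h1 := eps_le_kPair (tensorPow hn N) le_rfl hn y
      have h := (eOne_boxCons_of_noOneTwo (hn := hn) (x := x) hy).symm.trans h
      replace h := (boxE_eq_none le_rfl).1 (Option.map_eq_none_iff.1 h)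
      rw [hy.2] at h1
      omega
    · have h0 := eOne_eq_none_of_boxCons h
      rcases hz with ⟨rfl, -, hz⟩ | ⟨-, -, -, rfl⟩
      · refine (eOne_boxCons (hn := hn) ?_).trans (Option.map_eq_none_iff.2 (ih h0 hz))
        rwa [noOneTwo_iff_of_e_one hn hz]
      · exact (eOne_boxCons (hn := hn) hy).trans (Option.map_eq_none_iff.2 h0)

/-- The operator f̃_2 changes the leftmost unbracketed 2. As φ_2 ≥ 2, another 2 stands to its right,
so the rightmost letter among 1 and 2 is not touched. -/
theorem eOne_eq_none_of_f_two (h3 : 3 ≤ n) {N : ℕ} {z z' : (tensorPow hn N).carrier}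
    (hp : 2 ≤ (tensorPow hn N).phi 2 z) (hz : (tensorPow hn N).f 2 z = some z')
    (h : (tensorPow hn N).eOne z' = none) : (tensorPow hn N).eOne z = none := by
  induction N with
  | zero => rfl
  | succ N ih =>
    obtain ⟨x, y, rfl⟩ := exists_boxCons (B := tensorPow hn N) z
    have hp : 2 ≤ (tensorPow hn N).phi 2 y + ((if x.1 = 2 then 1 else 0) -
      (tensorPow hn N).eps 2 y) := hp
    have hk := phi_le_kPair (tensorPow hn N) (k := 2) (by omega) (by omega) y
    by_cases hx : x.1 = 2 ∧ (tensorPow hn N).eps 2 y = 0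
    · rw [if_pos hx.1] at hp
      have hy : ¬ NoOneTwo ((tensorPow hn N).wt y) := fun h => by
        rw [h.2] at hk
        omega
      have hf := f_boxCons_self (hn := hn) x ⟨3, by omega, h3⟩ y hx.2 hx.1 rfl
      obtain rfl := Option.some.inj (hf.symm.trans hz)
      have h1 := eOne_eq_none_of_boxCons h
      exact (eOne_boxCons (hn := hn) hy).trans (Option.map_eq_none_iff.2 h1)
    · have hf := (f_boxCons (hn := hn) (k := 2) x y (by omega)).symm.trans hz
      obtain ⟨y', hy', rfl⟩ := Option.map_eq_some_iff.1 hf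
      have hp' : 2 ≤ (tensorPow hn N).phi 2 y := by
        split_ifs at hp <;> omega
      have h1 := ih hp' hy' (eOne_eq_none_of_boxCons h)
      have hy : ¬ NoOneTwo ((tensorPow hn N).wt y) := fun h => by
        rw [h.2] at hk
        omega
      exact (eOne_boxCons (hn := hn) hy).trans (Option.map_eq_none_iff.2 h1)

/-- If some letter 1 or 2 occurred, the rightmost one would be a 1. Having no 2 to its right, it
would be unbracketed and give φ_1 > 0. -/
theorem noOneTwo_of_eOne_eq_none {N : ℕ} {z : (tensorPow hn N).carrier}
    (hp : (tensorPow hn N).phi 1 z = 0) (h : (tensorPow hn N).eOne z = none) :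
    NoOneTwo ((tensorPow hn N).wt z) := by
  induction N with
  | zero => constructor <;> simp [tensorPow, unit, kPair]
  | succ N ih =>
    obtain ⟨x, y, rfl⟩ := exists_boxCons (B := tensorPow hn N) z
    have hp : (tensorPow hn N).phi 1 y + ((if x.1 = 1 then 1 else 0) -
      (tensorPow hn N).eps 1 y) = 0 := hp
    have hy := ih (by omega) (eOne_eq_none_of_boxCons h)
    have he := eps_le_kPair (tensorPow hn N) le_rfl hn y
    rw [hy.2] at he
    have h := (eOne_boxCons_of_noOneTwo (hn := hn) (x := x) hy).symm.trans h
    replace h := (boxE_eq_none le_rfl).1 (Option.map_eq_none_iff.1 h)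
    have h1 : x.1 ≠ 1 := fun h => by
      rw [if_pos h] at hp
      omega
    have hw : ∀ a, 1 ≤ a → a ≤ 2 → kPair a ((tensorPow hn (N + 1)).wt (boxCons hn x y)) =
        kPair a ((tensorPow hn N).wt y) := by
      intro a ha ha'
      refine (kPair_add a _ _).trans ?_
      change kPair a (epsWt n x.1) + _ = _
      rw [kPair_epsWt a _ ha (by omega), if_neg (by omega), zero_add]
      rfl
    exact ⟨(hw 1 le_rfl (by omega)).trans hy.1, (hw 2 (by omega) le_rfl).trans hy.2⟩

theorem eOne_S_eq_none {k : ℕ} (hk : 3 ≤ k) (hkn : k < n) {u : B.carrier}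
    (h : B.eOne u = none) : B.eOne (B.S k u) = none := by
  have aux : ∀ g : B.carrier → Option B.carrier,
      (∀ b, (g b).bind B.eOne = (B.eOne b).bind g) → ∀ q u v, iter g q u = some v →
        B.eOne u = none → B.eOne v = none := by
    intro g hg q
    induction q with
    | zero =>
      intro u v hv hu
      simp only [iter, Option.some.injEq] at hv
      rwa [← hv]
    | succ q ih =>
      intro u v hv hu
      rw [iter, Option.bind_eq_some_iff] at hv
      obtain ⟨c, hc, hv⟩ := hv
      refine ih c v hv ?_
      have := hg u
      rwa [hc, hu, Option.bind_some, Option.bind_none] at this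
  rcases B.S_spec (by omega) hkn u with ⟨q, -, hq⟩ | ⟨q, -, hq⟩
  · exact aux _ (B.eOne_comm_f k hk hkn) _ _ _ hq h
  · exact aux _ (B.eOne_comm_e k hk hkn) _ _ _ hq h

/-- For k ≥ 3, ẽ_{1̄} commutes with ẽ_k and f̃_k, hence its vanishing is preserved by S_k, which is
an involution. -/
theorem eOne_SWord_eq_none {l : List ℕ} (hl : ∀ k ∈ l, 3 ≤ k ∧ k < n)
    {u : B.carrier} : B.eOne (B.SWord l u) = none ↔ B.eOne u = none := by
  induction l with
  | nil => rfl
  | cons k l ih =>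
    have hk := hl k List.mem_cons_self
    rw [SWord_cons, ← ih fun k hk => hl k (List.mem_cons_of_mem _ hk)]
    refine ⟨fun h => ?_, eOne_S_eq_none hk.1 hk.2⟩
    have := eOne_S_eq_none hk.1 hk.2 h
    rwa [S_S B (by omega) hk.2] at this

theorem eOdd_eq_none_iff (i : ℕ) (b : B.carrier) :
    B.eOdd i b = none ↔ B.eOne (B.SWord (wWord i) b) = none :=
  Option.map_eq_none_iff

end Words

/-! ### Extremal vectors over a dominant weight, and the reflection of b₀. -/

theorem IsGLHighest.kPair_le {b : B.carrier} (hb : B.IsGLHighest b) {a c : ℕ} (ha : 1 ≤ a)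
    (hac : a ≤ c) (hc : c ≤ n) : kPair c (B.wt b) ≤ kPair a (B.wt b) := by
  induction c, hac using Nat.le_induction with
  | base => exact le_rfl
  | succ c hac ih =>
    have h1 := B.phi_eq c (by omega) (by omega) b
    rw [B.eps_eq_zero c (by omega) (by omega) b (hb c (by omega) (by omega)), hPair] at h1
    have := ih (by omega)
    omega

theorem hPair_wt_SWord {l : List ℕ} (hl : IsWord n l) (u : B.carrier) {k a c : ℕ} (hk : 1 ≤ k)
    (hkn : k < n) (ha : act l k = a) (hc : act l (k + 1) = c) :
    hPair k (B.wt (B.SWord l u)) = kPair a (B.wt u) - kPair c (B.wt u) := by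
  rw [hPair, kPair_wt_SWord hl u hk (by omega), kPair_wt_SWord hl u (by omega) (by omega), ha, hc]

theorem IsRegular.e_SWord_eq_none_of_act (hB : B.IsRegular) {b : B.carrier}
    (hb : B.IsGLHighest b) {l : List ℕ} (hl : IsWord n l) {k a c : ℕ} (hk : 1 ≤ k) (hkn : k < n)
    (ha : act l k = a) (hc : act l (k + 1) = c) (h1 : 1 ≤ a) (hac : a ≤ c) (hcn : c ≤ n) :
    B.e k (B.SWord l b) = none := by
  refine e_SWord_eq_none hB hb hl hk hkn ?_
  rw [hPair_wt_SWord hl b hk hkn ha hc]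
  have := hb.kPair_le h1 hac hcn
  omega

theorem IsRegular.f_SWord_eq_none_of_act (hB : B.IsRegular) {b : B.carrier}
    (hb : B.IsGLHighest b) {l : List ℕ} (hl : IsWord n l) {k a c : ℕ} (hk : 1 ≤ k) (hkn : k < n)
    (ha : act l k = a) (hc : act l (k + 1) = c) (h1 : 1 ≤ c) (hac : c ≤ a) (hcn : a ≤ n) :
    B.f k (B.SWord l b) = none := by
  refine f_SWord_eq_none hB hb hl hk hkn ?_
  rw [hPair_wt_SWord hl b hk hkn ha hc]
  have := hb.kPair_le h1 hac hcn
  omega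

theorem kPair_wt_fDown {p : ℕ} (hp : p < n) {u v : B.carrier} (h : B.fDown p u = some v) {a : ℕ}
    (ha : 1 ≤ a) (han : a ≤ n) : kPair a (B.wt v) =
      kPair a (B.wt u) + (if a = p + 1 then 1 else 0) - if a = 1 then 1 else 0 := by
  induction p generalizing u with
  | zero => simp_all [fDown]
  | succ p ih =>
    rw [fDown, Option.bind_eq_some_iff] at h
    obtain ⟨c, hc, h⟩ := h
    rw [ih (by omega) h, B.wt_f _ (by omega) hp _ _ hc, sub_eq_add_neg (B.wt u), ← one_smul ℤ
      (simpleRoot n (p + 1)), ← neg_smul, kPair_add_smul_simpleRoot ha han]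
    ring

/-- The box `1`. -/
def oneBox (hn : 2 ≤ n) : Letter n := ⟨1, le_refl 1, le_trans one_le_two hn⟩

section

variable {hn : 2 ≤ n} (hB : B.IsRegular) {b : B.carrier} (hb : B.IsGLHighest b) {j : ℕ}
  (hjn : j ≤ n) {c : B.carrier}
include hB hb hjn

/-- The vectors d_m = f̃_1⋯f̃_{m-1} S_m⋯S_{j-1} b interpolate between c (m = j) and S_1⋯S_{j-1} b (m
= 1). With g = S_{m+1}⋯S_{j-1} b and S_m g = f̃_m^{q+1} g, the string commutation and the far
commutations give d_m = f̃_m^q d_{m+1}, so 1 ⊗ d_m never leaves the component of 1 ⊗ c. -/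
theorem IsRegular.exists_fDown_SWord (hc : B.fDown (j - 1) b = some c) {m : ℕ} (hm : 1 ≤ m)
    (hmj : m ≤ j) : ∃ d, B.fDown (m - 1) (B.SWord (List.Ico m j) b) = some d ∧
      (tensor hn (box n) B).Up (boxCons hn (oneBox hn) d) (boxCons hn (oneBox hn) c) := by
  induction hmj using Nat.decreasingInduction with
  | self => exact ⟨c, by rwa [List.Ico.self_empty], .refl⟩
  | of_succ m hmj ih =>
    obtain ⟨d', hd', hup⟩ := ih (by omega)
    have hl : IsWord n (List.Ico (m + 1) j) := isWord_Ico (by omega) hjn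
    have hem : B.e m (B.SWord (List.Ico (m + 1) j) b) = none := by
      refine hB.e_SWord_eq_none_of_act hb hl hm (by omega) (a := m) (c := j) ?_ ?_ hm (by omega) hjn
        <;> rw [act_Ico hmj] <;> split_ifs <;> omega
    have hS : B.SWord (List.Ico m j) b = B.S m (B.SWord (List.Ico (m + 1) j) b) := by
      rw [List.Ico.eq_cons hmj]
      rfl
    have hem' : 2 ≤ m → B.e (m - 1) (B.SWord (List.Ico (m + 1) j) b) = none := by
      intro h2
      refine hB.e_SWord_eq_none_of_act hb hl (by omega) (by omega) (a := m - 1) (c := m) ?_ ?_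
        (by omega) (by omega) (by omega)
        <;> rw [act_Ico hmj] <;> split_ifs <;> omega
    rw [hS]
    generalize B.SWord (List.Ico (m + 1) j) b = g at *
    have hd'' := hd'
    obtain ⟨p, rfl⟩ : ∃ p, m = p + 1 := ⟨m - 1, by omega⟩
    rw [Nat.add_sub_cancel] at hd' hem' ⊢
    rw [fDown, Option.bind_eq_some_iff] at hd'
    obtain ⟨g₁, hg₁, hd'⟩ := hd'
    have hphi := (f_isSome_iff B hm (by omega) g).1 ⟨g₁, hg₁⟩
    have hp := B.phi_eq (p + 1) hm (by omega) g
    rw [B.eps_eq_zero _ hm (by omega) g hem] at hp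
    obtain ⟨q, hq⟩ : ∃ q, iter (B.f (p + 1)) (q + 1) g = some (B.S (p + 1) g) := by
      rcases B.S_spec hm (by omega) g with ⟨q, hq, hs⟩ | ⟨q, hq, hs⟩
      · exact ⟨q - 1, by rwa [Nat.sub_add_cancel (by omega)]⟩
      · omega
    suffices ∃ d, B.fDown p (B.S (p + 1) g) = some d ∧ iter (B.f (p + 1)) q d' = some d ∧
        (p = 0 → 0 < B.eps 1 d') by
      obtain ⟨d, h1, h2, h3⟩ := this
      refine ⟨d, h1, hup.iter_f hm (by omega) (q := q) ?_⟩
      -- Only f̃_1 could act on the box 1; ε_1(d') > 0 keeps it on the second factor.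
      by_cases hp0 : p = 0
      · subst hp0
        exact iter_f_boxCons_self hm (by omega) _ q d' d (h3 rfl) h2
      · rw [iter_map (B.f (p + 1)) _ _ fun y => f_boxCons _ y (Or.inl ?_), h2]
        · rfl
        · change 1 ≠ p + 1
          omega
    rcases p with _ | p
    · simp only [fDown, Option.some.injEq] at hd'
      subst hd'
      refine ⟨B.S 1 g, rfl, ?_, fun _ => ?_⟩
      · rw [iter, hg₁] at hq
        exact hq
      · have := B.eps_f 1 le_rfl (by omega) _ _ hg₁
        omega
    · obtain ⟨h', r', r, e1, e2, e3, e4⟩ := hB.exists_f_string (i := p + 1) (by omega) (by omega)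
        hm (by omega) (Or.inl rfl) (hem' (by omega)) hem q hq
      rw [hg₁] at e1
      cases e1
      rw [fDown, e2, Option.bind_some] at hd'
      obtain ⟨d, hd, hd1⟩ := hB.fDown_iter_comm (by omega) le_rfl hd' e4
      refine ⟨d, ?_, hd, by omega⟩
      rw [fDown, e3]
      exact hd1

/-- Both sides lie in the component of 1 ⊗ c and have the same weight, and the left side is
extremal. -/
theorem IsRegular.SWord_boxCons_fDown (hj : 1 ≤ j) (hc : B.fDown (j - 1) b = some c)
    (hb₀ : (tensor hn (box n) B).IsGLHighest (boxCons hn (oneBox hn) c)) :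
    (tensor hn (box n) B).SWord (List.Ico 1 j) (boxCons hn (oneBox hn) c) =
      boxCons hn (oneBox hn) (B.SWord (List.Ico 1 j) b) := by
  obtain ⟨d, hd, hup⟩ := hB.exists_fDown_SWord (hn := hn) hb hjn hc le_rfl hj
  obtain rfl : B.SWord (List.Ico 1 j) b = d := Option.some.inj hd
  have hl : IsWord n (List.Ico 1 j) := isWord_Ico le_rfl hjn
  refine (SWord_eq_of_wt hB.boxTensor hb₀ hl hup (weight_ext fun a ha han => ?_)).symm
  have hact := act_Ico hj a
  have h1 : 1 ≤ act (List.Ico 1 j) a ∧ act (List.Ico 1 j) a ≤ n := by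
    rw [hact]
    split_ifs <;> omega
  have hw : ∀ a, 1 ≤ a → a ≤ n → ∀ y, kPair a ((tensor hn (box n) B).wt
      (boxCons hn (oneBox hn) y)) = (if a = 1 then 1 else 0) + kPair a (B.wt y) := by
    intro a ha han y
    refine (kPair_add a _ _).trans ?_
    congr 1
    exact kPair_epsWt a 1 ha han
  rw [kPair_wt_SWord hl _ ha han, hw a ha han, hw _ h1.1 h1.2, kPair_wt_SWord hl _ ha han,
    kPair_wt_fDown (by omega) hc h1.1 h1.2, Nat.sub_add_cancel hj, hact]
  split_ifs <;> first | (exfalso; omega) | ring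

end

/-! ### Identities between permutations. -/

theorem act_wWord {i : ℕ} (hi : 1 ≤ i) (a : ℕ) (ha : 1 ≤ a) : act (wWord i) a =
    if a = 1 then i else if a = 2 then i + 1 else if a ≤ i + 1 then a - 2 else a := by
  rw [wWord, act_append, act_Ico hi, act_Ico (by omega)]
  split_ifs <;> omega

/-- Conjugation by w_i turns s_m into s_{m+2} for m ≤ i - 2. This lets s_1⋯s_{j-1} be inserted at
the right of w_i at the cost of reflections of index at least 3. -/
theorem act_wWord_append_Ico {i j : ℕ} (hj : 1 ≤ j) (hij : j < i) (a : ℕ) (ha : 1 ≤ a) :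
    act (List.Ico 3 (j + 2) ++ wWord i) a = act (wWord i ++ List.Ico 1 j) a := by
  rw [act_append, act_append, act_Ico hj, act_Ico (by omega), act_wWord (by omega) a ha]
  have h1 : 1 ≤ if a = 3 then j + 2 else if 3 < a ∧ a ≤ j + 2 then a - 1 else a := by
    split_ifs <;> omega
  rw [act_wWord (by omega) _ h1]
  rcases Nat.lt_or_ge (j + 2) a with h2 | h2
  · rw [if_neg (show a ≠ 3 by omega), if_neg (show ¬ (3 < a ∧ a ≤ j + 2) by omega),
      if_neg (show a ≠ 1 by omega), if_neg (show a ≠ 2 by omega)]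
    split_ifs <;> omega
  · split_ifs <;> omega

theorem act_Ico_two_one_one {i j : ℕ} (hj : 1 ≤ j) (hij : j < i) :
    act (List.Ico (1 + 1) i ++ List.Ico 1 j) 1 = j := by
  rw [act_append, act_Ico hj, act_Ico (by omega)]
  split_ifs <;> omega

theorem act_Ico_two_one_two {i j : ℕ} (hj : 1 ≤ j) (hij : j < i) :
    act (List.Ico (1 + 1) i ++ List.Ico 1 j) (1 + 1) = i := by
  rw [act_append, act_Ico hj, act_Ico (by omega)]
  split_ifs <;> omega

theorem act_Ico_three_two_one_two {i j : ℕ} (hj : 1 ≤ j) (hij : j < i) :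
    act (List.Ico (2 + 1) (i + 1) ++ 1 :: (List.Ico (1 + 1) i ++ List.Ico 1 j)) 2 = j := by
  rw [act_append, act_Ico (by omega), if_neg (by omega), if_neg (by omega), act, if_neg (by omega),
    if_pos rfl, act_Ico_two_one_one hj hij]

theorem act_Ico_three_two_one_three {i j : ℕ} (hj : 1 ≤ j) (hij : j < i) :
    act (List.Ico (2 + 1) (i + 1) ++ 1 :: (List.Ico (1 + 1) i ++ List.Ico 1 j)) (2 + 1) =
      i + 1 := by
  rw [act_append, act_Ico (by omega), if_pos rfl, act, if_neg (by omega), if_neg (by omega),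
    act_append, act_Ico (p := 1 + 1) (by omega), if_neg (by omega), if_neg (by omega), act_Ico hj,
    if_neg (by omega), if_neg (by omega)]

theorem act_three_Ico {i j : ℕ} (hi : 1 ≤ i) (hij : i + 1 < j) (a : ℕ) (ha : 1 ≤ a) :
    act ((List.Ico 3 (i + 2) ++ List.Ico 2 (i + 1)) ++ List.Ico 1 j) a =
      if a = 1 then j else if a = 2 then i else if a = 3 then i + 1 else
        if a ≤ i + 2 then a - 3 else if a ≤ j then a - 1 else a := by
  rw [act_append, act_append, act_Ico (p := 3) (by omega)]
  by_cases h : a = 3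
  · subst h
    rw [if_pos rfl, act_Ico (p := 2) (by omega), act_Ico (p := 1) (by omega)]
    split_ifs <;> omega
  by_cases h' : a ≤ i + 2
  · by_cases h2 : a ≤ 2
    · rw [if_neg h, if_neg (by omega), act_Ico (p := 2) (by omega), act_Ico (p := 1) (by omega)]
      split_ifs <;> omega
    · rw [if_neg h, if_pos (by omega), act_Ico (p := 2) (by omega), if_neg (by omega), if_pos (by omega),
        act_Ico (p := 1) (by omega)]
      split_ifs <;> omega
  · rw [if_neg h, if_neg (by omega), act_Ico (p := 2) (by omega), if_neg (by omega), if_neg (by omega),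
      act_Ico (p := 1) (by omega)]
    split_ifs <;> omega

/-- The counterpart for j > i + 1: besides reflections of index at least 3, a factor s_2 s_1 has to
be handled on the left. -/
theorem act_Ico_append_wWord {i j : ℕ} (hi : 1 ≤ i) (hij : i + 1 < j) (a : ℕ) (ha : 1 ≤ a) :
    act (List.Ico 3 j ++ wWord i) a =
      act (2 :: 1 :: ((List.Ico 3 (i + 2) ++ List.Ico 2 (i + 1)) ++ List.Ico 1 j)) a := by
  rw [act_append, act_Ico (by omega), act, act]
  obtain rfl | rfl | rfl | h : a = 1 ∨ a = 2 ∨ a = 3 ∨ 3 < a := by omega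
  · change act (wWord i) 1 = act _ 2
    rw [act_wWord hi _ (by omega), act_three_Ico hi hij _ (by omega)]
    rfl
  · change act (wWord i) 2 = act _ 3
    rw [act_wWord hi _ (by omega), act_three_Ico hi hij _ (by omega)]
    rfl
  · change act (wWord i) j = act _ 1
    rw [act_wWord hi _ (by omega), act_three_Ico hi hij _ (by omega)]
    split_ifs <;> omega
  · simp only [if_neg (show a ≠ 2 by omega), if_neg (show a ≠ 2 + 1 by omega),
      if_neg (show a ≠ 1 by omega)]
    rw [act_three_Ico hi hij a ha]
    by_cases h' : a ≤ j
    · rw [if_pos (by omega), act_wWord hi _ (by omega)]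
      split_ifs <;> omega
    · rw [if_neg (by omega), act_wWord hi _ (by omega)]
      split_ifs <;> omega

theorem isWord_wWord {i : ℕ} (hin : i < n) : IsWord n (wWord i) :=
  isWord_append.2 ⟨isWord_Ico (by omega) hin, isWord_Ico le_rfl hin.le⟩

/-! ### Strictness of highest weights, and the four positions of i relative to j. -/

section Highest

variable {hn : 2 ≤ n} {N : ℕ}

/-- The coefficients of ε_1 and ε_2 in wt(S_{w_i} h) are those of ε_i and ε_{i+1} in wt h. If these
agree, extremality gives φ_1 = 0, and with ẽ_{1̄} = 0 both must be zero. -/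
theorem IsHighest.hPair_pos {h : (tensorPow hn N).carrier} (hh : (tensorPow hn N).IsHighest h)
    {i : ℕ} (hi : 1 ≤ i) (hin : i < n) (hp : 0 < kPair (i + 1) ((tensorPow hn N).wt h)) :
    0 < hPair i ((tensorPow hn N).wt h) := by
  have hB := isRegular_tensorPow hn N
  have hgl : (tensorPow hn N).IsGLHighest h := fun i hi hin => (hh i hi hin).1
  have hle := hgl.kPair_le hi (Nat.le_succ i) hin
  by_contra hcon
  rw [hPair] at hcon
  have hw := isWord_wWord (n := n) hin
  have h1 : act (wWord i) 1 = i := by rw [act_wWord hi _ le_rfl, if_pos rfl]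
  have h2 : act (wWord i) 2 = i + 1 := by
    rw [act_wWord hi _ (by omega), if_neg (by omega), if_pos rfl]
  have hz := hPair_wt_SWord hw h le_rfl hn h1 h2
  have hf := f_SWord_eq_none hB hgl hw le_rfl hn (by omega)
  have hphi : (tensorPow hn N).phi 1 ((tensorPow hn N).SWord (wWord i) h) = 0 :=
    (tensorPow hn N).phi_eq_zero 1 le_rfl hn _ hf
  have he := (eOdd_eq_none_iff i h).1 (hh i hi hin).2
  have h0 := (noOneTwo_of_eOne_eq_none hphi he).2
  rw [kPair_wt_SWord hw _ (by omega) hn, h2] at h0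
  omega

variable {b : (tensorPow hn N).carrier} (hb : (tensorPow hn N).IsGLHighest b) {j : ℕ}
  (hj : 1 ≤ j) (hjn : j ≤ n) {c : (tensorPow hn N).carrier}
  (hc : (tensorPow hn N).fDown (j - 1) b = some c)
  (hb₀ : (tensor hn (box n) (tensorPow hn N)).IsGLHighest (boxCons hn (oneBox hn) c))
include hb hj hjn hc hb₀

theorem eOne_SWord_of_eq {i : ℕ} (hij : j = i) (hin : i < n)
    (h : (tensor hn (box n) (tensorPow hn N)).eOne ((tensor hn (box n) (tensorPow hn N)).SWord
      (wWord i) (boxCons hn (oneBox hn) c)) = none) :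
    (tensorPow hn N).eOne ((tensorPow hn N).SWord (wWord i) b) = none := by
  subst hij
  rw [wWord, SWord_append, (isRegular_tensorPow hn N).SWord_boxCons_fDown hb hjn hj hc hb₀,
    SWord_boxCons (isWord_Ico (by omega) (by omega))] at h
  · rw [wWord, SWord_append]
    exact eOne_eq_none_of_boxCons h
  · intro k hk
    rw [List.Ico.mem] at hk
    change 1 ≠ k ∧ 1 ≠ k + 1
    omega

theorem eOne_SWord_of_eq_succ {i : ℕ} (hi : 1 ≤ i) (hij : j = i + 1) (hin : i < n)
    (h : (tensor hn (box n) (tensorPow hn N)).eOne ((tensor hn (box n) (tensorPow hn N)).SWord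
      (wWord i) (boxCons hn (oneBox hn) c)) = none) :
    (tensorPow hn N).eOne ((tensorPow hn N).SWord (wWord i) b) = none := by
  subst hij
  have hB := isRegular_tensorPow hn N
  have hl : IsWord n (List.Ico 2 (i + 1) ++ List.Ico 1 (i + 1)) :=
    isWord_append.2 ⟨isWord_Ico (by omega) (by omega), isWord_Ico le_rfl hjn⟩
  have hl' : IsWord n (1 :: (List.Ico 2 (i + 1) ++ List.Ico 1 (i + 1))) :=
    isWord_cons.2 ⟨⟨le_rfl, hn⟩, hl⟩
  have hact : ∀ a, 1 ≤ a → a ≤ n →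
      act (wWord i) a = act (1 :: (List.Ico 2 (i + 1) ++ List.Ico 1 (i + 1))) a := by
    intro a ha han
    rw [act_wWord hi a ha]
    simp only [act, act_append]
    rw [act_Ico (by omega), act_Ico (by omega)]
    split_ifs <;> omega
  rw [SWord_eq_SWord hB.boxTensor hb₀ (isWord_wWord hin) hl' hact, SWord_cons, SWord_append,
    hB.SWord_boxCons_fDown hb hjn hj hc hb₀, SWord_boxCons (isWord_Ico (by omega) (by omega))] at h
  swap
  · intro k hk
    rw [List.Ico.mem] at hk
    change 1 ≠ k ∧ 1 ≠ k + 1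
    omega
  rw [SWord_eq_SWord hB hb (isWord_wWord hin) hl' hact, SWord_cons]
  rw [← SWord_append] at h
  have h1 : act (List.Ico 2 (i + 1) ++ List.Ico 1 (i + 1)) 1 = i + 1 := by
    rw [act_append, act_Ico (by omega), act_Ico (by omega)]
    split_ifs <;> omega
  have h2 : act (List.Ico 2 (i + 1) ++ List.Ico 1 (i + 1)) (1 + 1) = i := by
    rw [act_append, act_Ico (by omega), act_Ico (by omega)]
    split_ifs <;> omega
  -- The innermost operator of `fDown i` is f̃_i, so f̃_i b ≠ 0 and λ_i > λ_{i+1}.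
  have hp : kPair (i + 1) ((tensorPow hn N).wt b) < kPair i ((tensorPow hn N).wt b) := by
    rw [Nat.add_sub_cancel] at hc
    obtain ⟨p, rfl⟩ : ∃ p, i = p + 1 := ⟨i - 1, by omega⟩
    rw [fDown, Option.bind_eq_some_iff] at hc
    obtain ⟨d, hd, -⟩ := hc
    have := (f_isSome_iff _ hi hin b).1 ⟨d, hd⟩
    have h3 := (tensorPow hn N).phi_eq _ hi hin b
    rw [(tensorPow hn N).eps_eq_zero _ hi hin b (hb _ hi hin), hPair] at h3
    omega
  have hw := hPair_wt_SWord hl b le_rfl hn h1 h2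
  obtain ⟨y, hy, hS⟩ := exists_S_boxCons_eq (hn := hn) le_rfl hn (oneBox hn) _ rfl
    (hB.f_SWord_eq_none_of_act hb hl le_rfl hn h1 h2 hi (by omega) hjn)
    (by omega)
  rw [hS] at h
  exact eOne_eq_none_of_e_one (eOne_eq_none_of_boxCons h)
    (((tensorPow hn N).f_iff_e 1 le_rfl hn _ _).1 hy)

/-- Write w_i = s_2 (s_3⋯s_i) s_1 (s_2⋯s_{i-1}). On 1 ⊗ S_1⋯S_{j-1} b only the isolated S_1 and S_2
move the box, to 2 and then to 3. The second factor undergoes S_{w_i}, since it is at the top of the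
relevant string each time. -/
theorem eOne_SWord_of_lt {i : ℕ} (hij : j < i) (hin : i < n)
    (h : (tensor hn (box n) (tensorPow hn N)).eOne ((tensor hn (box n) (tensorPow hn N)).SWord
      (wWord i) (boxCons hn (oneBox hn) c)) = none) :
    (tensorPow hn N).eOne ((tensorPow hn N).SWord (wWord i) b) = none := by
  have hB := isRegular_tensorPow hn N
  have hl : IsWord n (List.Ico 3 (j + 2) ++ wWord i) :=
    isWord_append.2 ⟨isWord_Ico (by omega) (by omega), isWord_wWord hin⟩
  have hl' : IsWord n (wWord i ++ List.Ico 1 j) :=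
    isWord_append.2 ⟨isWord_wWord hin, isWord_Ico le_rfl hjn⟩
  have hact : ∀ a, 1 ≤ a → a ≤ n →
      act (List.Ico 3 (j + 2) ++ wWord i) a = act (wWord i ++ List.Ico 1 j) a :=
    fun a ha _ => act_wWord_append_Ico hj hij a ha
  have h3 : ∀ k ∈ List.Ico 3 (j + 2), 3 ≤ k ∧ k < n := fun k hk => by
    rw [List.Ico.mem] at hk
    omega
  rw [← eOne_SWord_eq_none h3, ← SWord_append, SWord_eq_SWord hB hb hl hl' hact]
  rw [← eOne_SWord_eq_none h3, ← SWord_append, SWord_eq_SWord hB.boxTensor hb₀ hl hl' hact,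
    SWord_append, hB.SWord_boxCons_fDown hb hjn hj hc hb₀, wWord, List.Ico.eq_cons (n := 2)
    (by omega), List.Ico.eq_cons (n := 1) (m := i) (by omega), SWord_append, SWord_cons, SWord_cons,
    SWord_boxCons (isWord_Ico (by omega) (by omega)), ← SWord_append] at h
  swap
  · intro k hk
    rw [List.Ico.mem] at hk
    change 1 ≠ k ∧ 1 ≠ k + 1
    omega
  have hl1 : IsWord n (List.Ico (1 + 1) i ++ List.Ico 1 j) :=
    isWord_append.2 ⟨isWord_Ico (by omega) (by omega), isWord_Ico le_rfl hjn⟩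
  have hl2 : IsWord n (List.Ico (2 + 1) (i + 1) ++ 1 :: (List.Ico (1 + 1) i ++ List.Ico 1 j)) :=
    isWord_append.2 ⟨isWord_Ico (by omega) (by omega), isWord_cons.2 ⟨⟨le_rfl, hn⟩, hl1⟩⟩
  have he1 := hB.e_SWord_eq_none_of_act hb hl1 le_rfl hn (act_Ico_two_one_one hj hij)
    (act_Ico_two_one_two hj hij) hj hij.le hin.le
  have he2 := hB.e_SWord_eq_none_of_act hb hl2 (k := 2) one_le_two (by omega)
    (act_Ico_three_two_one_two hj hij) (act_Ico_three_two_one_three hj hij) hj (by omega) hin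
  rw [S_boxCons_self le_rfl hn _ ⟨2, by omega, hn⟩ _ rfl rfl he1,
    SWord_boxCons (isWord_Ico (by omega) (by omega)), ← SWord_cons 1, ← SWord_append,
    S_boxCons_self (k := 2) one_le_two (by omega) _ ⟨3, by omega, by omega⟩ _ rfl rfl he2] at h
  · have := eOne_eq_none_of_boxCons h
    rwa [← SWord_cons, ← List.cons_append, ← List.cons_append, ← List.append_assoc,
      ← List.Ico.eq_cons (by omega), ← List.Ico.eq_cons (by omega)] at this
  · intro k hk
    rw [List.Ico.mem] at hk
    change 2 ≠ k ∧ 2 ≠ k + 1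
    omega

/-- The hypothesis concerns S_2 f̃_1 g and the goal concerns v = S_2 g. The string commutation
identifies S_2 f̃_1 g with f̃_1 f̃_2 v, and `hgap` says that φ_2(v) ≥ 2. -/
theorem eOne_SWord_of_gt {i : ℕ} (hi : 1 ≤ i) (hij : i + 1 < j)
    (hgap : kPair j ((tensorPow hn N).wt b) + 2 ≤ kPair (i + 1) ((tensorPow hn N).wt b))
    (h : (tensor hn (box n) (tensorPow hn N)).eOne ((tensor hn (box n) (tensorPow hn N)).SWord
      (wWord i) (boxCons hn (oneBox hn) c)) = none) :
    (tensorPow hn N).eOne ((tensorPow hn N).SWord (wWord i) b) = none := by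
  have hB := isRegular_tensorPow hn N
  have hin : i < n := by omega
  have hl0 : IsWord n (List.Ico 3 (i + 2) ++ List.Ico 2 (i + 1)) :=
    isWord_append.2 ⟨isWord_Ico (by omega) (by omega), isWord_Ico (by omega) (by omega)⟩
  have hl1 : IsWord n ((List.Ico 3 (i + 2) ++ List.Ico 2 (i + 1)) ++ List.Ico 1 j) :=
    isWord_append.2 ⟨hl0, isWord_Ico le_rfl hjn⟩
  have hl2 := isWord_cons.2 ⟨⟨le_rfl, hn⟩, hl1⟩
  have hl3 := isWord_cons.2 ⟨⟨one_le_two, show 2 < n by omega⟩, hl2⟩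
  have hl : IsWord n (List.Ico 3 j ++ wWord i) :=
    isWord_append.2 ⟨isWord_Ico (by omega) (by omega), isWord_wWord hin⟩
  have hact : ∀ a, 1 ≤ a → a ≤ n → act (List.Ico 3 j ++ wWord i) a =
      act (2 :: 1 :: ((List.Ico 3 (i + 2) ++ List.Ico 2 (i + 1)) ++ List.Ico 1 j)) a :=
    fun a ha _ => act_Ico_append_wWord hi hij a ha
  have h3 : ∀ k ∈ List.Ico 3 j, 3 ≤ k ∧ k < n := fun k hk => by
    rw [List.Ico.mem] at hk
    omega
  rw [← eOne_SWord_eq_none h3, ← SWord_append, SWord_eq_SWord hB hb hl hl3 hact]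
  rw [← eOne_SWord_eq_none h3, ← SWord_append, SWord_eq_SWord hB.boxTensor hb₀ hl hl3 hact,
    SWord_cons, SWord_cons, SWord_append, hB.SWord_boxCons_fDown hb hjn hj hc hb₀,
    SWord_boxCons hl0, ← SWord_append] at h
  swap
  · intro k hk
    rw [List.mem_append, List.Ico.mem, List.Ico.mem] at hk
    change 1 ≠ k ∧ 1 ≠ k + 1
    omega
  have hdom := hb.kPair_le (c := i + 1) hi (by omega) (by omega)
  have a1 : act ((List.Ico 3 (i + 2) ++ List.Ico 2 (i + 1)) ++ List.Ico 1 j) 1 = j := by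
    rw [act_three_Ico hi hij 1 le_rfl, if_pos rfl]
  have a2 : act ((List.Ico 3 (i + 2) ++ List.Ico 2 (i + 1)) ++ List.Ico 1 j) 2 = i := by
    rw [act_three_Ico hi hij 2 (by omega), if_neg (by omega), if_pos rfl]
  have a3 : act ((List.Ico 3 (i + 2) ++ List.Ico 2 (i + 1)) ++ List.Ico 1 j) 3 = i + 1 := by
    rw [act_three_Ico hi hij 3 (by omega), if_neg (by omega), if_neg (by omega), if_pos rfl]
  have hw1 := hPair_wt_SWord hl1 b le_rfl hn a1 a2
  have hw2 := hPair_wt_SWord hl2 b (k := 2) (a := j) (c := i + 1) (by omega) (by omega)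
    (by rw [act]; exact a1) (by rw [act]; exact a3)
  have hw3 := hPair_wt_SWord hl3 b (k := 2) (a := i + 1) (c := j) (by omega) (by omega)
    (by rw [act, act]; exact a3) (by rw [act, act]; exact a1)
  have he1 := hB.e_SWord_eq_none_of_act hb hl3 (k := 1) (a := i) (c := i + 1) le_rfl hn
    (by rw [act, act]; exact a2) (by rw [act, act]; exact a3) hi (by omega) (by omega)
  have he2 := hB.e_SWord_eq_none_of_act hb hl3 (k := 2) (a := i + 1) (c := j) (by omega) (by omega)
    (by rw [act, act]; exact a3) (by rw [act, act]; exact a1) (by omega) (by omega) (by omega)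
  obtain ⟨y, hy, hS⟩ := exists_S_boxCons_eq (hn := hn) le_rfl hn (oneBox hn) _ rfl
    (hB.f_SWord_eq_none_of_act hb hl1 le_rfl hn a1 a2 hi (by omega) hjn) (by omega)
  rw [hS, S_boxCons (by omega) (by omega) _ _ (by change 1 ≠ 2; omega)
    (by change 1 ≠ 3; omega)] at h
  replace h := eOne_eq_none_of_boxCons h
  rw [← SWord_cons] at hy
  rw [SWord_cons 2] at he1 he2 hw3 ⊢
  generalize (tensorPow hn N).SWord
    (1 :: ((List.Ico 3 (i + 2) ++ List.Ico 2 (i + 1)) ++ List.Ico 1 j)) b = g at *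
  have hgg := S_S (tensorPow hn N) one_le_two (show 2 < n by omega) g
  obtain ⟨s, hs, hiter⟩ : ∃ s : ℕ, hPair 2 ((tensorPow hn N).wt g) = -(s + 1) ∧
      iter ((tensorPow hn N).f 2) (s + 1) ((tensorPow hn N).S 2 g) = some g := by
    rcases S_spec (tensorPow hn N) one_le_two (show 2 < n by omega) ((tensorPow hn N).S 2 g)
      with ⟨q, hq, hs⟩ | ⟨q, hq, hs⟩
    · rw [hgg] at hs
      refine ⟨q - 1, by omega, ?_⟩
      rwa [Nat.sub_add_cancel (by omega)]
    · omega
  have hphi := (tensorPow hn N).phi_eq 2 one_le_two (by omega) ((tensorPow hn N).S 2 g)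
  obtain ⟨h', r', r, e1, e2, e3, e4⟩ := hB.exists_f_string le_rfl hn one_le_two
    (show 2 < n by omega) (Or.inl rfl) he1 he2 s hiter
  rw [hy] at e3
  cases e3
  -- Applying f̃_1 raises ⟨h_2, ·⟩ from -(s+1) to -s, so S_2 is ẽ_2^s here and leads to r'.
  rw [S_eq_of_iter_e _ one_le_two (show 2 < n by omega) (q := s) (v := r')] at h
  · refine eOne_eq_none_of_f_two (by omega) (by omega) e1
      (eOne_eq_none_of_e_one h (((tensorPow hn N).f_iff_e 1 le_rfl hn _ _).1 e2))
  · rw [(tensorPow hn N).wt_f 1 le_rfl hn _ _ hy, sub_eq_add_neg,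
      ← one_smul ℤ (simpleRoot n 1), ← neg_smul,
      hPair_add_smul_simpleRoot_adj (i := 2) (k := 1) (by omega) (by omega) (Or.inr rfl), hs]
    ring
  · exact (iter_f_iff_iter_e _ one_le_two (by omega) _ _ _).1 e4

end Highest
end Crystal
end QueerCrystal

/-- Here `N` stands for N - 1 in the informal statement, which encodes N ≥ 1. -/
theorem mainTheorem6 (n : ℕ) (hn : 2 ≤ n) (N : ℕ)
    (b : (QueerCrystal.Crystal.tensorPow hn N).carrier)
    (hb : (QueerCrystal.Crystal.tensorPow hn N).IsGLHighest b)
    (j : ℕ) (hj : 1 ≤ j) (hjn : j ≤ n)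
    (c : (QueerCrystal.Crystal.tensorPow hn N).carrier)
    (hc : (QueerCrystal.Crystal.tensorPow hn N).fDown (j - 1) b = some c)
    (hb₀ : (QueerCrystal.Crystal.tensorPow hn (N + 1)).IsHighest
      (QueerCrystal.Crystal.consBox hn ⟨1, le_refl 1, le_trans one_le_two hn⟩ c)) :
    (QueerCrystal.Crystal.tensorPow hn N).IsHighest b := by
  open QueerCrystal QueerCrystal.Crystal in
  intro i hi hin
  refine ⟨hb i hi hin, (eOdd_eq_none_iff i b).2 ?_⟩
  have hgl : (tensor hn (box n) (tensorPow hn N)).IsGLHighest (boxCons hn (oneBox hn) c) :=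
    fun i hi hin => (hb₀ i hi hin).1
  have h : (tensor hn (box n) (tensorPow hn N)).eOne ((tensor hn (box n) (tensorPow hn N)).SWord
      (wWord i) (boxCons hn (oneBox hn) c)) = none :=
    (eOdd_eq_none_iff (B := tensorPow hn (N + 1)) i _).1 (hb₀ i hi hin).2
  rcases lt_trichotomy j i with hji | hji | hji
  · exact eOne_SWord_of_lt hb hj hjn hc hgl hji hin h
  · exact eOne_SWord_of_eq hb hj hjn hc hgl hji hin h
  rcases Nat.eq_or_lt_of_le (show i + 1 ≤ j from hji) with hji' | hji'
  · exact eOne_SWord_of_eq_succ hb hj hjn hc hgl hi hji'.symm hin h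
  refine eOne_SWord_of_gt hb hj hjn hc hgl hi hji' ?_ h
  have hw : ∀ a, 1 ≤ a → a ≤ n → kPair a ((tensorPow hn (N + 1)).wt
      (consBox hn (oneBox hn) c)) = (if a = j then 1 else 0) + kPair a ((tensorPow hn N).wt b) := by
    intro a ha han
    refine (kPair_add a _ _).trans ?_
    change kPair a (epsWt n 1) + _ = _
    rw [kPair_epsWt a 1 ha han]
    refine (congrArg _ (kPair_wt_fDown (by omega) hc ha han)).trans ?_
    rw [Nat.sub_add_cancel hj]
    ring
  have hj0 := kPair_nonneg j _ ((tensorPow hn N).wt_nonneg b)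
  have hj1 := hw j hj hjn
  have hj2 := hw (j - 1) (by omega) (by omega)
  -- Strictness of λ + ε_j at j - 1 gives λ_{j-1} > λ_j + 1; dominance of λ carries the gap from j -
  -- 1 up to i + 1.
  have hpos := IsHighest.hPair_pos (hn := hn) (N := N + 1) hb₀ (i := j - 1) (by omega) (by omega)
  rw [hPair, Nat.sub_add_cancel hj] at hpos
  have hpos' : kPair j ((tensorPow hn (N + 1)).wt (consBox hn (oneBox hn) c)) <
      kPair (j - 1) ((tensorPow hn (N + 1)).wt (consBox hn (oneBox hn) c)) := by
    refine sub_pos.1 (hpos ?_)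
    change 0 < kPair j ((tensorPow hn (N + 1)).wt (consBox hn (oneBox hn) c))
    rw [hj1, if_pos rfl]
    omega
  rw [hj1, hj2, if_pos rfl, if_neg (by omega)] at hpos'
  have := hb.kPair_le (a := i + 1) (c := j - 1) (by omega) (by omega) (by omega)
  omega
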